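/- **Setting.** Let $N_L\ge 1$ and let $m_\ell,n_\ell,r_\ell$ ($1\le \ell\le N_L$) be integers with $1\le r_\ell\le\min\{m_\ell,n_\ell\}$. A parameter vector $x\in\mathbb{R}^d$, $d=\sum_\ell m_\ell n_\ell$, collects the entries of weight matrices $X_\ell\in\mathbb{R}^{m_\ell\times n_\ell}$; $\nabla_\ell$ denotes the gradient with respect to $X_\ell$. Let $f(x)=\mathbb{E}_{\xi\sim\mathcal D}F(x;\xi)$ and assume: (i) $\inf_x f(x)>-\infty$; (ii) $f$ is differentiable and $\|\nabla f(x)-\nabla f(y)\|_2\le L\|x-y\|_2$ for all $x,y$, where $L>0$; (iii) for all $x$ and $\ell$, $\mathbb{E}_{\xi\sim\mathcal D}[\nabla_\ell F(x;\xi)]=\nabla_\ell f(x)$ and $\mathbb{E}_{\xi\sim\mathcal D}\|\nabla_\ell F(x;\xi)-\nabla_\ell f(x)\|_F^2\le\sigma_\ell^2$. Put $\sigma=\sqrt{\sum_\ell\sigma_\ell^2}$, $\underline\delta=\min_\ell \frac{r_\ell}{\min\{m_\ell,n_\ell\}}$ and $\Delta=f(x^{(0)})-\inf_x f(x)$. **Algorithm**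 (GoLore with small-batch stochastic gradients, momentum SGD and momentum projection; inputs $x^{(0)},\beta_1,\tau,\eta$). Let $\mathcal U(\mathrm{St}_{a,b})$ be the uniform (orthogonally invariant) distribution on $\mathrm{St}_{a,b}=\{P\in\mathbb{R}^{a\times b}: P^\top P=I_b\}$. Set $M_\ell^{(-1)}=0$. For $t=0,1,2,\dots$ draw $\xi^{(t)}\sim\mathcal D$ and let $G_\ell^{(t)}=\nabla_\ell F(x^{(t)};\xi^{(t)})$. For each $\ell$ with $m_\ell\le n_\ell$: if $\tau\mid t$, draw $P_\ell^{(t)}\sim\mathcal U(\mathrm{St}_{m_\ell,r_\ell})$ and set $M_\ell^{(t)}=(1-\beta_1)(P_\ell^{(t)})^\top P_\ell^{(t-1)}M_\ell^{(t-1)}+\beta_1(P_\ell^{(t)})^\top G_\ell^{(t)}$; otherwise set $P_\ell^{(t)}=P_\ell^{(t-1)}$ and $M_\ell^{(t)}=(1-\beta_1)M_\ell^{(t-1)}+\beta_1(P_\ell^{(t)})^\top G_\ell^{(t)}$; then $X_\ell^{(t+1)}=X_\ell^{(t)}-\eta P_\ell^{(t)}M_\ell^{(t)}$. For each $\ell$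 with $m_\ell>n_\ell$: if $\tau\mid t$, draw $Q_\ell^{(t)}\sim\mathcal U(\mathrm{St}_{n_\ell,r_\ell})$ and set $M_\ell^{(t)}=(1-\beta_1)M_\ell^{(t-1)}(Q_\ell^{(t-1)})^\top Q_\ell^{(t)}+\beta_1 G_\ell^{(t)}Q_\ell^{(t)}$; otherwise set $Q_\ell^{(t)}=Q_\ell^{(t-1)}$ and $M_\ell^{(t)}=(1-\beta_1)M_\ell^{(t-1)}+\beta_1 G_\ell^{(t)}Q_\ell^{(t)}$; then $X_\ell^{(t+1)}=X_\ell^{(t)}-\eta M_\ell^{(t)}(Q_\ell^{(t)})^\top$. All draws are independent. (At $t=0$ the term with $M_\ell^{(-1)}$ is zero.) **Theorem.** There is an absolute constant $C>0$ such that in every such setting the following hold, with all expectations finite. 1. If $$0<\beta_1\le1,\qquad \tau\ge\frac{64}{3\beta_1\underline\delta},\qquad 0<\eta\le\min\left\{\frac1{4L},\sqrt{\frac{3\underline\delta\beta_1^2}{80L^2}},\sqrt{\frac{3\underline\delta}{80\tau^2L^2}},\sqrt{\frac{3\beta_1}{16\tau L^2}}\right\}$$ with $\tau$ an integer, then for every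 integer $K\ge1$ $$\frac1{K\tau}\sum_{t=0}^{K\tau-1}\mathbb{E}\|\nabla f(x^{(t)})\|_2^2\le\frac{16\Delta}{\underline\delta\,\eta K\tau}+\frac{32\beta_1\sigma^2}{3\underline\delta}.$$ 2. If $\Delta>0$, then for every integer $T\ge 2+\frac{128}{3\underline\delta}+\frac{(128\sigma)^2}{9\sqrt{\underline\delta}L\Delta}$, with the choice $$\beta_1=\left(1+\sqrt{\frac{\underline\delta^{3/2}\sigma^2T}{L\Delta}}\right)^{-1},\quad \tau=\left\lceil\frac{64}{3\underline\delta\beta_1}\right\rceil,\quad \eta=\left(4L+\sqrt{\frac{80L^2}{3\underline\delta\beta_1^2}}+\sqrt{\frac{80\tau^2L^2}{3\underline\delta}}+\sqrt{\frac{16\tau L^2}{3\beta_1}}\right)^{-1},$$ $$\frac1T\sum_{t=0}^{T-1}\mathbb{E}\|\nabla f(x^{(t)})\|_2^2\le C\left(\frac{L\Delta}{\underline\delta^{5/2}T}+\sqrt{\frac{L\Delta\sigma^2}{\underline\delta^{7/2}T}}\right).$$ 3. Consequently, if $\Delta>0$, then for every $\varepsilon>0$ there is an integer $T_0\le C\left(\frac{L\Delta\sigma^2}{\underline\delta^{7/2}\varepsilon^2}+\frac{L\Delta}{\underline\delta^{5/2}\varepsilon}+\frac{\sigma^2}{\underline\delta^{1/2}L\Delta}+\frac1{\underline\delta}\right)$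 such that every integer $T\ge T_0$ satisfies the lower bound on $T$ in 2, and $T$ iterations (one stochastic gradient each) with the choice in 2 give $\frac1T\sum_{t=0}^{T-1}\mathbb{E}\|\nabla f(x^{(t)})\|_2^2\le\varepsilon$. -/

import Mathlib

open MeasureTheory ProbabilityTheory

noncomputable section

namespace GoLore

/-! ### The Stiefel manifold and its uniform distribution -/

/-- Real matrices carry the product (that is, Borel) σ-algebra. -/
instance instMeasurableSpaceMatrix {a b : Type*} : MeasurableSpace (Matrix a b ℝ) :=
  inferInstanceAs (MeasurableSpace (a → b → ℝ))

instance instBorelSpaceMatrix {a b : Type*} [Countable a] [Countable b] :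
    BorelSpace (Matrix a b ℝ) :=
  inferInstanceAs (BorelSpace (a → b → ℝ))

instance instCompactSpaceOrthogonalGroup (k : ℕ) :
    CompactSpace (Matrix.orthogonalGroup (Fin k) ℝ) := by
  let K : Set (Matrix (Fin k) (Fin k) ℝ) :=
    Set.pi Set.univ fun _ => Set.pi Set.univ fun _ => Set.Icc (-1 : ℝ) 1
  have hK : IsCompact K :=
    isCompact_univ_pi fun _ => isCompact_univ_pi fun _ => isCompact_Icc
  have hsub : ((Matrix.orthogonalGroup (Fin k) ℝ : Submonoid _) :
      Set (Matrix (Fin k) (Fin k) ℝ)) ⊆ K := by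
    intro U hU i _ j _
    have h := entry_norm_bound_of_unitary (𝕜 := ℝ) hU i j
    exact abs_le.mp h
  have hcl : IsClosed ((Matrix.orthogonalGroup (Fin k) ℝ : Submonoid _) :
      Set (Matrix (Fin k) (Fin k) ℝ)) := by
    have : ((Matrix.orthogonalGroup (Fin k) ℝ : Submonoid _) :
        Set (Matrix (Fin k) (Fin k) ℝ)) = {U | U * U.transpose = 1} := by
      ext U
      exact Matrix.mem_orthogonalGroup_iff (Fin k) ℝ
    rw [this]
    exact isClosed_eq (by fun_prop) continuous_const
  exact isCompact_iff_compactSpace.mp (hK.of_isClosed_subset hcl hsub)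

/-- The first `b` columns of an `a × a` matrix `U`, written as `U * J`, where `J` is the `a × b`
matrix with ones on its main diagonal and zeros elsewhere. -/
def firstColumns {a : ℕ} (b : ℕ) (U : Matrix (Fin a) (Fin a) ℝ) : Matrix (Fin a) (Fin b) ℝ :=
  U * (Matrix.of fun i j => if (i : ℕ) = (j : ℕ) then 1 else 0 : Matrix (Fin a) (Fin b) ℝ)

/-- The uniform distribution on the Stiefel manifold `{P : P.transpose * P = 1}` of `a × b`
matrices, `b ≤ a`: the law of the first `b` columns of a Haar-distributed random orthogonal
`a × a` matrix. It is the only probability measure on the Stiefel manifold that is invariant under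
`P ↦ O * P` for all orthogonal `O`. -/
def stiefelUniform (a b : ℕ) : Measure (Matrix (Fin a) (Fin b) ℝ) :=
  Measure.map (fun U : Matrix.orthogonalGroup (Fin a) ℝ => firstColumns b U.1)
    (Measure.haarMeasure
      (⊤ : TopologicalSpace.PositiveCompacts (Matrix.orthogonalGroup (Fin a) ℝ)))

/-! ### Parameters and gradient oracle -/

variable {N : ℕ} {m n r : Fin N → ℕ}

/-- The parameter vector `x` that collects the entries of all weight matrices
`X_ℓ ∈ ℝ^(m_ℓ × n_ℓ)`, with the Euclidean norm. -/
abbrev Params (m n : Fin N → ℕ) : Type :=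
  EuclideanSpace ℝ (Σ ℓ : Fin N, Fin (m ℓ) × Fin (n ℓ))

/-- The `ℓ`-th weight matrix of a parameter vector. Applied to a gradient, it gives the gradient
with respect to the `ℓ`-th weight matrix. -/
def block (x : Params m n) (ℓ : Fin N) : Matrix (Fin (m ℓ)) (Fin (n ℓ)) ℝ :=
  Matrix.of fun i j => x ⟨ℓ, i, j⟩

/-- The parameter vector with given weight matrices. -/
def assemble (X : ∀ ℓ, Matrix (Fin (m ℓ)) (Fin (n ℓ)) ℝ) : Params m n :=
  WithLp.toLp 2 fun p => X p.1 p.2.1 p.2.2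

/-- The square of the Frobenius norm. -/
def frobSq {a b : ℕ} (A : Matrix (Fin a) (Fin b) ℝ) : ℝ := ∑ i, ∑ j, A i j ^ 2

/-- The stochastic gradient `∇F(x; ξ)` (the gradient is in `x`). -/
def stochGrad {Ξ : Type*} (F : Params m n → Ξ → ℝ) (x : Params m n) (ξ : Ξ) : Params m n :=
  gradient (fun y => F y ξ) x

/-- The objective `f(x) = 𝔼_{ξ ∼ D} F(x; ξ)`. -/
def objective {Ξ : Type*} [MeasurableSpace Ξ] (F : Params m n → Ξ → ℝ) (D : Measure Ξ)
    (x : Params m n) : ℝ := ∫ ξ, F x ξ ∂D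

/-- `f` is differentiable with `L`-Lipschitz gradient. -/
def LSmooth (f : Params m n → ℝ) (L : ℝ) : Prop :=
  Differentiable ℝ f ∧ ∀ x y, ‖gradient f x - gradient f y‖ ≤ L * ‖x - y‖

/-- The standing assumption on the gradient oracle `(F, D)`: the stochastic gradient is unbiased
and its `ℓ`-th block has variance at most `σ_ℓ²`. The first three fields and the integrability
fields say that the loss, its gradient and the expectations in question make sense. -/
structure StochasticGradient {Ξ : Type*} [MeasurableSpace Ξ] (F : Params m n → Ξ → ℝ)
    (D : Measure Ξ) (σ : Fin N → ℝ) : Prop where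
  integrable_loss : ∀ x, Integrable (F x) D
  differentiable : ∀ x, ∀ᵐ ξ ∂D, DifferentiableAt ℝ (fun y => F y ξ) x
  measurable_grad : Measurable fun p : Params m n × Ξ => stochGrad F p.1 p.2
  integrable_grad : ∀ x, Integrable (stochGrad F x) D
  unbiased : ∀ x, ∫ ξ, stochGrad F x ξ ∂D = gradient (objective F D) x
  integrable_sq : ∀ x ℓ, Integrable
    (fun ξ => frobSq (block (stochGrad F x ξ) ℓ - block (gradient (objective F D) x) ℓ)) D
  variance_le : ∀ x ℓ,
    ∫ ξ, frobSq (block (stochGrad F x ξ) ℓ - block (gradient (objective F D) x) ℓ) ∂D ≤ σ ℓ ^ 2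

/-- `σ = √(∑ σ_ℓ²)`. -/
def totalSigma (σ : Fin N → ℝ) : ℝ := √(∑ ℓ, σ ℓ ^ 2)

/-- `δ = min_ℓ r_ℓ / min (m_ℓ, n_ℓ)` (for `N ≥ 1`). -/
def minDelta (m n r : Fin N → ℕ) : ℝ := ⨅ ℓ, (r ℓ : ℝ) / (min (m ℓ) (n ℓ) : ℕ)

/-- `Δ = f(x⁰) - inf f`. -/
def gap (f : Params m n → ℝ) (x₀ : Params m n) : ℝ := f x₀ - ⨅ x, f x

/-! ### The algorithm -/

/-- From matrices `S 0, S 1, …` the one in use at time `t`: it is refreshed at the times divisible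
by `τ` and kept otherwise. -/
def held {α : Type*} (τ : ℕ) (S : ℕ → α) : ℕ → α
  | 0 => S 0
  | t + 1 => if τ ∣ t + 1 then S (t + 1) else held τ S t

/-- The iterate `x^(t)`, together with the momenta `M_ℓ^(t-1)`. The momentum of a layer `ℓ` with
`m_ℓ ≤ n_ℓ` is the `r_ℓ × n_ℓ` matrix `left ℓ`, that of a layer with `m_ℓ > n_ℓ` is the
`m_ℓ × r_ℓ` matrix `right ℓ`. The other component of each layer is not used. -/
structure State (m n r : Fin N → ℕ) where
  x : Params m n
  left : ∀ ℓ, Matrix (Fin (r ℓ)) (Fin (n ℓ)) ℝ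
  right : ∀ ℓ, Matrix (Fin (m ℓ)) (Fin (r ℓ)) ℝ

/-- One iteration, at time `t`, of momentum SGD with momentum projection in the subspaces given by
`P`, `Q` (those of time `t`) and `P'`, `Q'` (those of time `t - 1`), with stochastic gradient `G`.
-/
def step (β η : ℝ) (τ t : ℕ)
    (P P' : ∀ ℓ, Matrix (Fin (m ℓ)) (Fin (r ℓ)) ℝ)
    (Q Q' : ∀ ℓ, Matrix (Fin (n ℓ)) (Fin (r ℓ)) ℝ)
    (G : Params m n) (s : State m n r) : State m n r :=
  let left : ∀ ℓ, Matrix (Fin (r ℓ)) (Fin (n ℓ)) ℝ := fun ℓ =>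
    (1 - β) • (if τ ∣ t then (P ℓ).transpose * P' ℓ * s.left ℓ else s.left ℓ)
      + β • ((P ℓ).transpose * block G ℓ)
  let right : ∀ ℓ, Matrix (Fin (m ℓ)) (Fin (r ℓ)) ℝ := fun ℓ =>
    (1 - β) • (if τ ∣ t then s.right ℓ * (Q' ℓ).transpose * Q ℓ else s.right ℓ)
      + β • (block G ℓ * Q ℓ)
  { x := assemble fun ℓ =>
      if m ℓ ≤ n ℓ then block s.x ℓ - η • (P ℓ * left ℓ)
      else block s.x ℓ - η • (right ℓ * (Q ℓ).transpose)
    left := left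
    right := right }

/-- The run of GoLore (small-batch stochastic gradients, momentum SGD with momentum projection)
from `x₀`, on the data points `ξ 0, ξ 1, …` and the sampled projection matrices `P t ℓ`, `Q t ℓ`
(of which only those with `τ ∣ t` are used). At `t = 0` the momenta are zero, so that the
projections "of time `-1`" are irrelevant. -/
def run {Ξ : Type*} (F : Params m n → Ξ → ℝ) (β η : ℝ) (τ : ℕ) (x₀ : Params m n) (ξ : ℕ → Ξ)
    (P : ℕ → ∀ ℓ, Matrix (Fin (m ℓ)) (Fin (r ℓ)) ℝ)
    (Q : ℕ → ∀ ℓ, Matrix (Fin (n ℓ)) (Fin (r ℓ)) ℝ) : ℕ → State m n r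
  | 0 => ⟨x₀, 0, 0⟩
  | t + 1 =>
    let s := run F β η τ x₀ ξ P Q t
    step β η τ t (held τ P t) (held τ P (t - 1)) (held τ Q t) (held τ Q (t - 1))
      (stochGrad F s.x (ξ t)) s

/-- The random inputs of the algorithm: data points `ξ_t ∼ D` and projection matrices
`P_{t,ℓ}`, `Q_{t,ℓ}` uniform on their Stiefel manifolds. The data points are independent, the pairs
`(P_{t,ℓ}, Q_{t,ℓ})` are independent, and the data points are independent of the projections. -/
structure Sampling {Ω Ξ : Type*} [MeasurableSpace Ω] [MeasurableSpace Ξ] (μ : Measure Ω)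
    (D : Measure Ξ) (ξ : ℕ → Ω → Ξ)
    (P : ℕ → ∀ ℓ, Ω → Matrix (Fin (m ℓ)) (Fin (r ℓ)) ℝ)
    (Q : ℕ → ∀ ℓ, Ω → Matrix (Fin (n ℓ)) (Fin (r ℓ)) ℝ) : Prop where
  measurable_data : ∀ t, Measurable (ξ t)
  law_data : ∀ t, μ.map (ξ t) = D
  measurable_left : ∀ t ℓ, Measurable (P t ℓ)
  law_left : ∀ t ℓ, μ.map (P t ℓ) = stiefelUniform (m ℓ) (r ℓ)
  measurable_right : ∀ t ℓ, Measurable (Q t ℓ)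
  law_right : ∀ t ℓ, μ.map (Q t ℓ) = stiefelUniform (n ℓ) (r ℓ)
  indep_data : iIndepFun ξ μ
  indep_proj : iIndepFun (fun (i : ℕ × Fin N) ω => (P i.1 i.2 ω, Q i.1 i.2 ω)) μ
  indep_data_proj : IndepFun (fun ω t => ξ t ω)
    (fun ω (i : ℕ × Fin N) => (P i.1 i.2 ω, Q i.1 i.2 ω)) μ

/-- The random iterate `x^(t)` of GoLore. -/
def iterate {Ω Ξ : Type*} (F : Params m n → Ξ → ℝ) (β η : ℝ) (τ : ℕ) (x₀ : Params m n)
    (ξ : ℕ → Ω → Ξ)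
    (P : ℕ → ∀ ℓ, Ω → Matrix (Fin (m ℓ)) (Fin (r ℓ)) ℝ)
    (Q : ℕ → ∀ ℓ, Ω → Matrix (Fin (n ℓ)) (Fin (r ℓ)) ℝ) (t : ℕ) (ω : Ω) : Params m n :=
  (run F β η τ x₀ (fun s => ξ s ω) (fun s ℓ => P s ℓ ω) (fun s ℓ => Q s ℓ ω) t).x

/-! ### The hyperparameters for a horizon of `T` iterations -/

/-- `β₁ = (1 + √(δ^{3/2} σ² T / (L Δ)))⁻¹`. -/
def betaT (δ σ L Δ : ℝ) (T : ℕ) : ℝ := (1 + √(δ ^ (3 / 2 : ℝ) * σ ^ 2 * T / (L * Δ)))⁻¹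

/-- `τ = ⌈64 / (3 δ β₁)⌉`. -/
def tauT (δ σ L Δ : ℝ) (T : ℕ) : ℕ := ⌈64 / (3 * δ * betaT δ σ L Δ T)⌉₊

/-- `η = (4L + √(80L²/(3δβ₁²)) + √(80τ²L²/(3δ)) + √(16τL²/(3β₁)))⁻¹`. -/
def etaT (δ σ L Δ : ℝ) (T : ℕ) : ℝ :=
  (4 * L + √(80 * L ^ 2 / (3 * δ * betaT δ σ L Δ T ^ 2))
    + √(80 * (tauT δ σ L Δ T : ℝ) ^ 2 * L ^ 2 / (3 * δ))
    + √(16 * (tauT δ σ L Δ T : ℝ) * L ^ 2 / (3 * betaT δ σ L Δ T)))⁻¹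

end GoLore

end

open GoLore

/-! Lift each layer's momentum back to full size: it becomes `P_ℓ M_ℓ`, or `M_ℓ Q_ℓᵀ`. With `A_t`
the blockwise orthogonal projection in use at time `t`, refresh and non-refresh steps obey a single
recursion `M_{t+1} = A_t((1-β) M_t + β G_t)`, `x_{t+1} = x_t - η M_{t+1}`. The rest of the
convergence argument takes place in a Hilbert space (`ProjectedMomentum`) and uses two probabilistic
facts. First, the gradient noise is centred and independent of the current state, so it enters the
momentum error only with weight `β²`. Second, a freshly drawn projection is independent of the
current iterate, and `𝔼 P Pᵀ = (r/m) I`; so at each refresh the projection keeps on average at least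
the fraction `δ` of the gradient's energy.

Since `M_{t+1}` lies in the range of `A_t`, Pythagoras splits `‖M_{t+1} - ∇f‖²` into the error `u`
inside the subspace and the part `v` of the gradient outside it. The descent lemma then bounds the
loss decrease by `g = 𝔼‖∇f‖²` and the squared displacement `d`, at the price of `u + v`.

The sum of `v` is at most `(1 - δ/2) ∑ g` plus drift: at a refresh `v ≤ (1 - δ) g`, and Lipschitz
continuity carries this through the period. The error `u` contracts by `1 - β` per step, but each
refresh adds a term of size `g`. There is one refresh per period, and a single `g` is comparable to
its average over the period, so these terms cost about `8/(βτ) ∑ g`; the lower bound on `τ` makes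
this at most `(3δ/8) ∑ g`. Thus `∑ (u + v) ≤ (1 - δ/8) ∑ g` plus noise and displacement terms, and
the step-size conditions let the descent inequality absorb the displacement. What remains is a bound
on `(δ/8) ∑ g` (`ScalarRecursion.average_le`).

For a horizon `T` the chosen `η` is of order `δ^{3/2} β / L` or larger, and `β = 1/(1+q)` balances
the optimization term, of order `LΔ(1+q)/(δ^{5/2}T)`, against the noise term `βσ²/δ`. The horizon
condition ensures `τ ≤ T`, so rounding `T` up to whole periods at most doubles it. -/

namespace GoLore

/-! ### Second moments of the uniform distribution on the Stiefel manifold -/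

/-- The Haar probability measure on the orthogonal group. -/
noncomputable abbrev orthogonalHaar (a : ℕ) : Measure (Matrix.orthogonalGroup (Fin a) ℝ) :=
  Measure.haarMeasure (⊤ : TopologicalSpace.PositiveCompacts (Matrix.orthogonalGroup (Fin a) ℝ))

instance isProbabilityMeasure_orthogonalHaar (a : ℕ) :
    IsProbabilityMeasure (orthogonalHaar a) :=
  ⟨by simpa using Measure.haarMeasure_self (K₀ :=
    (⊤ : TopologicalSpace.PositiveCompacts (Matrix.orthogonalGroup (Fin a) ℝ)))⟩

lemma continuous_orthogonalGroup_entry {a : ℕ} (i j : Fin a) :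
    Continuous fun U : Matrix.orthogonalGroup (Fin a) ℝ => U.1 i j :=
  continuous_subtype_val.matrix_elem i j

lemma measurable_firstColumns (a b : ℕ) :
    Measurable fun U : Matrix.orthogonalGroup (Fin a) ℝ => firstColumns b U.1 := by
  apply Continuous.measurable
  unfold firstColumns
  fun_prop

instance isProbabilityMeasure_stiefelUniform (a b : ℕ) :
    IsProbabilityMeasure (stiefelUniform a b) :=
  Measure.isProbabilityMeasure_map (measurable_firstColumns a b).aemeasurable

lemma firstColumns_apply {a b : ℕ} (h : b ≤ a) (U : Matrix (Fin a) (Fin a) ℝ) (i : Fin a)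
    (j : Fin b) : firstColumns b U i j = U i (Fin.castLE h j) := by
  simp only [firstColumns, Matrix.mul_apply, Matrix.of_apply, mul_ite, mul_one, mul_zero]
  rw [Finset.sum_eq_single (Fin.castLE h j)]
  · simp
  · intro k _ hk
    rw [if_neg]
    intro hkj
    exact hk (Fin.ext (by simpa using hkj))
  · simp

lemma transpose_mul_firstColumns {a b : ℕ} (h : b ≤ a)
    (U : Matrix.orthogonalGroup (Fin a) ℝ) :
    (firstColumns b U.1).transpose * firstColumns b U.1 = 1 := by
  have hU : U.1.transpose * U.1 = 1 := (Matrix.mem_orthogonalGroup_iff' (Fin a) ℝ).1 U.2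
  ext i j
  have := congrFun (congrFun hU (Fin.castLE h i)) (Fin.castLE h j)
  simp only [Matrix.mul_apply, Matrix.transpose_apply, firstColumns_apply h] at this ⊢
  rw [this]
  simp [Matrix.one_apply]

lemma ae_stiefelUniform {a b : ℕ} (h : b ≤ a) :
    ∀ᵐ P ∂(stiefelUniform a b), P.transpose * P = 1 := by
  have hcl : MeasurableSet {P : Matrix (Fin a) (Fin b) ℝ | P.transpose * P = 1} :=
    (isClosed_eq (by fun_prop) continuous_const).measurableSet
  rw [stiefelUniform, ae_map_iff (measurable_firstColumns a b).aemeasurable hcl]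
  exact Filter.Eventually.of_forall fun U => transpose_mul_firstColumns h U

lemma integrable_orthogonalHaar {a : ℕ} {g : Matrix.orthogonalGroup (Fin a) ℝ → ℝ}
    (hg : Continuous g) : Integrable g (orthogonalHaar a) :=
  hg.integrable_of_hasCompactSupport (HasCompactSupport.of_compactSpace g)

/-- Flipping the sign of row `i` is an orthogonal left multiplication, so it preserves Haar measure,
but it negates the integrand. -/
lemma integral_entry_mul_entry_of_ne {a : ℕ} {i j : Fin a} (hij : i ≠ j) (k : Fin a) :
    ∫ U, U.1 i k * U.1 j k ∂(orthogonalHaar a) = 0 := by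
  let d : Fin a → ℝ := fun l => if l = i then -1 else 1
  have hd : ∀ l, d l * d l = 1 := fun l => by by_cases h : l = i <;> simp [d, h]
  let O : Matrix.orthogonalGroup (Fin a) ℝ := ⟨Matrix.diagonal d, by
    rw [Matrix.mem_orthogonalGroup_iff, Matrix.diagonal_transpose, Matrix.diagonal_mul_diagonal]
    simp [hd]⟩
  have h := integral_mul_left_eq_self (μ := orthogonalHaar a)
    (fun U : Matrix.orthogonalGroup (Fin a) ℝ => U.1 i k * U.1 j k) O
  have h2 : ∀ U : Matrix.orthogonalGroup (Fin a) ℝ,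
      (O * U).1 i k * (O * U).1 j k = -(U.1 i k * U.1 j k) := by
    intro U
    have : ∀ l, (O * U).1 l k = d l * U.1 l k := fun l => by
      change (Matrix.diagonal d * U.1) l k = _
      rw [Matrix.diagonal_mul]
    rw [this, this]
    simp [d, hij.symm]
  simp only [h2, integral_neg] at h
  linarith

/-- Left multiplication by the permutation matrix that swaps rows `i` and `j` preserves Haar
measure. -/
lemma integral_entry_sq_eq {a : ℕ} (i j k : Fin a) :
    ∫ U, U.1 i k * U.1 i k ∂(orthogonalHaar a) = ∫ U, U.1 j k * U.1 j k ∂(orthogonalHaar a) := by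
  let O : Matrix.orthogonalGroup (Fin a) ℝ :=
    ⟨(Equiv.swap i j).toPEquiv.toMatrix, by
      rw [Matrix.mem_orthogonalGroup_iff, ← PEquiv.toMatrix_symm, ← PEquiv.toMatrix_trans,
        ← Equiv.toPEquiv_symm, ← Equiv.toPEquiv_trans]
      simp⟩
  have h := integral_mul_left_eq_self (μ := orthogonalHaar a)
    (fun U : Matrix.orthogonalGroup (Fin a) ℝ => U.1 i k * U.1 i k) O
  rw [← h]
  have : ∀ U : Matrix.orthogonalGroup (Fin a) ℝ, (O * U).1 i k = U.1 j k := fun U => by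
    change ((Equiv.swap i j).toPEquiv.toMatrix * U.1 : Matrix (Fin a) (Fin a) ℝ) i k = _
    rw [PEquiv.toMatrix_toPEquiv_mul]
    simp
  simp only [this]

/-- The entries of column `k` have equal second moments, and these sum to `1` because the column is
a unit vector. -/
lemma integral_entry_sq {a : ℕ} (i k : Fin a) :
    ∫ U, U.1 i k * U.1 i k ∂(orthogonalHaar a) = 1 / a := by
  have hint : ∀ l : Fin a, Integrable
      (fun U : Matrix.orthogonalGroup (Fin a) ℝ => U.1 l k * U.1 l k) (orthogonalHaar a) :=
    fun l => integrable_orthogonalHaar ((continuous_orthogonalGroup_entry l k).mul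
      (continuous_orthogonalGroup_entry l k))
  have hsum : ∑ l, ∫ U, U.1 l k * U.1 l k ∂(orthogonalHaar a) = 1 := by
    rw [← integral_finsetSum _ fun l _ => hint l]
    have : ∀ U : Matrix.orthogonalGroup (Fin a) ℝ, ∑ l, U.1 l k * U.1 l k = 1 := fun U => by
      have hU : U.1.transpose * U.1 = 1 := (Matrix.mem_orthogonalGroup_iff' (Fin a) ℝ).1 U.2
      simpa [Matrix.mul_apply] using congrFun (congrFun hU k) k
    simp [this]
  rw [Finset.sum_congr rfl fun l _ => integral_entry_sq_eq l i k] at hsum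
  simp only [Finset.sum_const, Finset.card_univ, Fintype.card_fin, nsmul_eq_mul] at hsum
  have ha : (a : ℝ) ≠ 0 := fun h => by simp [h] at hsum
  rw [eq_div_iff ha, mul_comm]
  exact hsum

lemma integral_gram_stiefelUniform {a b : ℕ} (h : b ≤ a) (i j : Fin a) :
    ∫ P, (P * P.transpose) i j ∂(stiefelUniform a b) = if i = j then (b : ℝ) / a else 0 := by
  have hc : Continuous fun P : Matrix (Fin a) (Fin b) ℝ => (P * P.transpose) i j := by fun_prop
  rw [stiefelUniform, integral_map (measurable_firstColumns a b).aemeasurable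
    hc.aestronglyMeasurable]
  simp only [Matrix.mul_apply, Matrix.transpose_apply, firstColumns_apply h]
  rw [integral_finsetSum]
  · by_cases hij : i = j
    · subst hij
      simp only [integral_entry_sq, if_true]
      simp [div_eq_mul_inv]
    · simp [integral_entry_mul_entry_of_ne hij, hij]
  · intro k _
    exact integrable_orthogonalHaar ((continuous_orthogonalGroup_entry _ _).mul
      (continuous_orthogonalGroup_entry _ _))

lemma integrable_gram_stiefelUniform {a b : ℕ} (i j : Fin a) :
    Integrable (fun P => (P * P.transpose) i j) (stiefelUniform a b) := by
  have hc : Continuous fun P : Matrix (Fin a) (Fin b) ℝ => (P * P.transpose) i j := by fun_prop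
  rw [stiefelUniform, integrable_map_measure hc.aestronglyMeasurable
    (measurable_firstColumns a b).aemeasurable]
  apply integrable_orthogonalHaar
  unfold firstColumns
  fun_prop

lemma frobSq_eq_trace {a b : ℕ} (A : Matrix (Fin a) (Fin b) ℝ) :
    frobSq A = (A.transpose * A).trace := by
  simp only [frobSq, Matrix.trace, Matrix.diag, Matrix.mul_apply, Matrix.transpose_apply]
  rw [Finset.sum_comm]
  simp only [sq]

lemma frobSq_nonneg {a b : ℕ} (A : Matrix (Fin a) (Fin b) ℝ) : 0 ≤ frobSq A :=
  Finset.sum_nonneg fun _ _ => Finset.sum_nonneg fun _ _ => sq_nonneg _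

lemma frobSq_transpose {a b : ℕ} (A : Matrix (Fin a) (Fin b) ℝ) :
    frobSq A.transpose = frobSq A := by
  unfold frobSq
  rw [Finset.sum_comm]
  rfl

/-- As `P Pᵀ` is symmetric and idempotent, the squared norm is linear in `P Pᵀ`; hence second
moments of `P` suffice for its expectation. -/
lemma frobSq_proj {a b c : ℕ} {P : Matrix (Fin a) (Fin b) ℝ} (hP : P.transpose * P = 1)
    (A : Matrix (Fin a) (Fin c) ℝ) :
    frobSq (P * P.transpose * A) = ∑ i, ∑ j, (P * P.transpose) i j * (A * A.transpose) j i := by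
  have h : (P * P.transpose * A).transpose * (P * P.transpose * A)
      = A.transpose * (P * P.transpose * A) := by
    simp only [Matrix.transpose_mul, Matrix.transpose_transpose, Matrix.mul_assoc]
    rw [← Matrix.mul_assoc P.transpose P, hP, Matrix.one_mul]
  rw [frobSq_eq_trace, h, Matrix.trace_mul_comm, Matrix.mul_assoc, Matrix.trace]
  simp only [Matrix.diag, Matrix.mul_apply (M := P * P.transpose)]

/-- Uniformly random projections scale the expected squared norm by `b / a`. -/
lemma integral_frobSq_proj {a b c : ℕ} (h : b ≤ a) (A : Matrix (Fin a) (Fin c) ℝ) :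
    ∫ P, frobSq (P * P.transpose * A) ∂(stiefelUniform a b) = (b : ℝ) / a * frobSq A := by
  rw [integral_congr_ae ((ae_stiefelUniform h).mono fun P hP => frobSq_proj hP A)]
  have hint : ∀ i j, Integrable (fun P : Matrix (Fin a) (Fin b) ℝ =>
      (P * P.transpose) i j * (A * A.transpose) j i) (stiefelUniform a b) :=
    fun i j => (integrable_gram_stiefelUniform i j).mul_const _
  rw [integral_finsetSum _ fun i _ => integrable_finsetSum _ fun j _ => hint i j]
  simp_rw [integral_finsetSum _ fun j _ => hint _ j, integral_mul_const,
    integral_gram_stiefelUniform h]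
  simp only [ite_mul, zero_mul, Finset.sum_ite_eq, Finset.mem_univ, if_true]
  rw [← Finset.mul_sum, ← frobSq_transpose A, frobSq_eq_trace, Matrix.transpose_transpose]
  rfl

/-! ### Blocks of parameter vectors -/

section Blocks

variable {N : ℕ} {m n r : Fin N → ℕ}

@[simp] lemma block_assemble (X : ∀ ℓ, Matrix (Fin (m ℓ)) (Fin (n ℓ)) ℝ) (ℓ : Fin N) :
    block (assemble X) ℓ = X ℓ := rfl

lemma ext_block {x y : Params m n} (h : ∀ ℓ, block x ℓ = block y ℓ) : x = y := by
  ext ⟨ℓ, i, j⟩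
  exact congrFun (congrFun (h ℓ) i) j

@[simp] lemma block_add (x y : Params m n) (ℓ : Fin N) :
    block (x + y) ℓ = block x ℓ + block y ℓ := rfl

@[simp] lemma block_sub (x y : Params m n) (ℓ : Fin N) :
    block (x - y) ℓ = block x ℓ - block y ℓ := rfl

@[simp] lemma block_smul (c : ℝ) (x : Params m n) (ℓ : Fin N) :
    block (c • x) ℓ = c • block x ℓ := rfl

@[simp] lemma block_zero (ℓ : Fin N) : block (0 : Params m n) ℓ = 0 := rfl

lemma inner_eq_sum_trace (x y : Params m n) :
    inner ℝ x y = ∑ ℓ, ((block x ℓ).transpose * block y ℓ).trace := by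
  rw [PiLp.inner_apply, Fintype.sum_sigma]
  refine Finset.sum_congr rfl fun ℓ _ => ?_
  rw [Fintype.sum_prod_type, Finset.sum_comm]
  simp only [Matrix.trace, Matrix.diag, Matrix.mul_apply, Matrix.transpose_apply]
  refine Finset.sum_congr rfl fun j _ => Finset.sum_congr rfl fun i _ => ?_
  simp [block, mul_comm]

lemma norm_sq_eq_sum_frobSq (x : Params m n) : ‖x‖ ^ 2 = ∑ ℓ, frobSq (block x ℓ) := by
  rw [← real_inner_self_eq_norm_sq, inner_eq_sum_trace]
  simp only [frobSq_eq_trace]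

/-! ### Blockwise projections and the momentum in the full space -/

/-- The blockwise projection `v_ℓ ↦ P_ℓ P_ℓᵀ v_ℓ` (or `v_ℓ Q_ℓ Q_ℓᵀ`). -/
noncomputable def blockProj (P : ∀ ℓ, Matrix (Fin (m ℓ)) (Fin (r ℓ)) ℝ)
    (Q : ∀ ℓ, Matrix (Fin (n ℓ)) (Fin (r ℓ)) ℝ) : Params m n →ₗ[ℝ] Params m n where
  toFun v := assemble fun ℓ =>
    if m ℓ ≤ n ℓ then P ℓ * (P ℓ).transpose * block v ℓ
    else block v ℓ * (Q ℓ * (Q ℓ).transpose)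
  map_add' v w := by
    refine ext_block fun ℓ => ?_
    by_cases h : m ℓ ≤ n ℓ <;> simp [h, Matrix.mul_add, Matrix.add_mul]
  map_smul' c v := by
    refine ext_block fun ℓ => ?_
    by_cases h : m ℓ ≤ n ℓ <;> simp [h]

lemma block_blockProj (P : ∀ ℓ, Matrix (Fin (m ℓ)) (Fin (r ℓ)) ℝ)
    (Q : ∀ ℓ, Matrix (Fin (n ℓ)) (Fin (r ℓ)) ℝ) (v : Params m n) (ℓ : Fin N) :
    block (blockProj P Q v) ℓ = if m ℓ ≤ n ℓ then P ℓ * (P ℓ).transpose * block v ℓ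
      else block v ℓ * (Q ℓ * (Q ℓ).transpose) := rfl

/-- All matrices of the two families have orthonormal columns. -/
def Orthonormals (P : ∀ ℓ, Matrix (Fin (m ℓ)) (Fin (r ℓ)) ℝ)
    (Q : ∀ ℓ, Matrix (Fin (n ℓ)) (Fin (r ℓ)) ℝ) : Prop :=
  ∀ ℓ, (P ℓ).transpose * P ℓ = 1 ∧ (Q ℓ).transpose * Q ℓ = 1

variable {P P' : ∀ ℓ, Matrix (Fin (m ℓ)) (Fin (r ℓ)) ℝ}
  {Q Q' : ∀ ℓ, Matrix (Fin (n ℓ)) (Fin (r ℓ)) ℝ}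

lemma blockProj_inner (v w : Params m n) :
    inner ℝ (blockProj P Q v) w = inner ℝ v (blockProj P Q w) := by
  rw [inner_eq_sum_trace, inner_eq_sum_trace]
  refine Finset.sum_congr rfl fun ℓ _ => ?_
  rw [block_blockProj, block_blockProj]
  split_ifs
  · simp only [Matrix.transpose_mul, Matrix.transpose_transpose, Matrix.mul_assoc]
  · simp only [Matrix.transpose_mul, Matrix.transpose_transpose]
    rw [Matrix.mul_assoc, Matrix.trace_mul_comm]
    simp only [Matrix.mul_assoc]

lemma Orthonormals.blockProj_idem (h : Orthonormals P Q) (v : Params m n) :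
    blockProj P Q (blockProj P Q v) = blockProj P Q v := by
  refine ext_block fun ℓ => ?_
  simp only [block_blockProj]
  split_ifs
  · simp only [Matrix.mul_assoc]
    rw [← Matrix.mul_assoc (P ℓ).transpose (P ℓ), (h ℓ).1, Matrix.one_mul]
  · simp only [Matrix.mul_assoc]
    rw [← Matrix.mul_assoc (Q ℓ).transpose (Q ℓ), (h ℓ).2, Matrix.one_mul]

/-- The momentum as an element of the parameter space. -/
noncomputable def fullMomentum (P : ∀ ℓ, Matrix (Fin (m ℓ)) (Fin (r ℓ)) ℝ)
    (Q : ∀ ℓ, Matrix (Fin (n ℓ)) (Fin (r ℓ)) ℝ) (s : State m n r) : Params m n :=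
  assemble fun ℓ => if m ℓ ≤ n ℓ then P ℓ * s.left ℓ else s.right ℓ * (Q ℓ).transpose

lemma block_fullMomentum (s : State m n r) (ℓ : Fin N) :
    block (fullMomentum P Q s) ℓ
      = if m ℓ ≤ n ℓ then P ℓ * s.left ℓ else s.right ℓ * (Q ℓ).transpose := rfl

lemma step_x (β η : ℝ) (τ t : ℕ) (G : Params m n) (s : State m n r) :
    (step β η τ t P P' Q Q' G s).x
      = s.x - η • fullMomentum P Q (step β η τ t P P' Q Q' G s) := by
  refine ext_block fun ℓ => ?_
  by_cases h : m ℓ ≤ n ℓ <;> simp [step, h, block_fullMomentum]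

/-- At a refresh the update contains `P Pᵀ P' M'`, which is already the new projection applied to
the old full-size momentum; no orthonormality is needed. -/
lemma fullMomentum_step_of_dvd (β η : ℝ) {τ t : ℕ} (ht : τ ∣ t) (G : Params m n)
    (s : State m n r) :
    fullMomentum P Q (step β η τ t P P' Q Q' G s)
      = blockProj P Q ((1 - β) • fullMomentum P' Q' s + β • G) := by
  refine ext_block fun ℓ => ?_
  by_cases h : m ℓ ≤ n ℓ <;>
    simp [step, h, ht, block_fullMomentum, block_blockProj, Matrix.mul_add, Matrix.add_mul,
      Matrix.mul_assoc]

/-- Without a refresh the old momentum lies in the range of the unchanged projection (`Pᵀ P = 1`),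
so projecting it again is harmless and the formula of the refresh case persists. -/
lemma Orthonormals.fullMomentum_step_of_not_dvd (hPQ : Orthonormals P Q) (β η : ℝ) {τ t : ℕ}
    (ht : ¬ τ ∣ t) (G : Params m n) (s : State m n r) :
    fullMomentum P Q (step β η τ t P P' Q Q' G s)
      = blockProj P Q ((1 - β) • fullMomentum P Q s + β • G) := by
  refine ext_block fun ℓ => ?_
  by_cases h : m ℓ ≤ n ℓ
  · simp only [step, h, ht, block_fullMomentum, block_blockProj, if_true, if_false, block_add,
      block_smul, Matrix.mul_add, Matrix.mul_smul, Matrix.mul_assoc]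
    rw [← Matrix.mul_assoc (P ℓ).transpose (P ℓ), (hPQ ℓ).1, Matrix.one_mul]
  · simp only [step, h, ht, block_fullMomentum, block_blockProj, if_false, block_add,
      block_smul, Matrix.add_mul, Matrix.smul_mul, Matrix.mul_assoc]
    rw [← Matrix.mul_assoc (Q ℓ).transpose (Q ℓ), (hPQ ℓ).2, Matrix.one_mul]

lemma Orthonormals.isSymmetricProjection (h : Orthonormals P Q) :
    (blockProj P Q).IsSymmetricProjection :=
  ⟨LinearMap.ext h.blockProj_idem, blockProj_inner⟩

end Blocks

/-! ### Norm identities for symmetric projections -/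

section SymmetricProjection

variable {E : Type*} [NormedAddCommGroup E] [InnerProductSpace ℝ E] {A : E →ₗ[ℝ] E}

lemma _root_.LinearMap.IsSymmetricProjection.apply_apply (h : A.IsSymmetricProjection) (v : E) :
    A (A v) = A v := LinearMap.congr_fun h.isIdempotentElem v

/-- Pythagoras for the range of `A` and its orthogonal complement. -/
lemma _root_.LinearMap.IsSymmetricProjection.norm_sq_add (h : A.IsSymmetricProjection) (v : E) :
    ‖A v‖ ^ 2 + ‖v - A v‖ ^ 2 = ‖v‖ ^ 2 := by
  have h0 : inner ℝ v (A v) = ‖A v‖ ^ 2 := by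
    rw [← real_inner_self_eq_norm_sq, h.isSymmetric, h.apply_apply]
  rw [norm_sub_sq_real, h0]
  ring

lemma _root_.LinearMap.IsSymmetricProjection.norm_apply_le (h : A.IsSymmetricProjection) (v : E) :
    ‖A v‖ ≤ ‖v‖ := by
  refine le_of_sq_le_sq ?_ (norm_nonneg _)
  have := h.norm_sq_add v
  nlinarith [sq_nonneg ‖v - A v‖]

lemma _root_.LinearMap.IsSymmetricProjection.norm_sub_apply_le (h : A.IsSymmetricProjection)
    (v : E) : ‖v - A v‖ ≤ ‖v‖ := by
  refine le_of_sq_le_sq ?_ (norm_nonneg _)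
  have := h.norm_sq_add v
  nlinarith [sq_nonneg ‖A v‖]

/-- Splitting the error of an approximation `M` in the range of the projection. -/
lemma _root_.LinearMap.IsSymmetricProjection.norm_sub_sq (h : A.IsSymmetricProjection) {M : E}
    (hM : A M = M) (g : E) : ‖M - g‖ ^ 2 = ‖M - A g‖ ^ 2 + ‖g - A g‖ ^ 2 := by
  have := h.norm_sq_add (M - g)
  rw [map_sub, hM] at this
  rw [← this]
  congr 2
  rw [← norm_neg]
  congr 1
  abel

end SymmetricProjection

/-! ### Convexity inequalities for squared norms -/

section Convexity

lemma norm_add_sq_le_weighted {E : Type*} [SeminormedAddCommGroup E] {a : ℝ} (ha : 0 < a) (x y : E) :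
    ‖x + y‖ ^ 2 ≤ (1 + a) * ‖x‖ ^ 2 + (1 + 1 / a) * ‖y‖ ^ 2 := by
  have h1 : ‖x + y‖ ^ 2 ≤ (‖x‖ + ‖y‖) ^ 2 := by gcongr; exact norm_add_le x y
  have h2 : (1 + a) * ‖x‖ ^ 2 + (1 + 1 / a) * ‖y‖ ^ 2 - (‖x‖ + ‖y‖) ^ 2
      = (a * ‖x‖ - ‖y‖) ^ 2 / a := by
    field_simp
    ring
  have h3 : 0 ≤ (a * ‖x‖ - ‖y‖) ^ 2 / a := by positivity
  linarith

variable {E : Type*} [NormedAddCommGroup E] [InnerProductSpace ℝ E]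

/-- Young's inequality with weight `β / (1 - β)`, one factor `1 - β` being spent on the weight. The
argument never divides by `1 - β`, so `β = 1` is covered. -/
lemma norm_smul_add_sq_le {β : ℝ} (hβ : 0 < β) (hβ1 : β ≤ 1) (x y : E) :
    ‖(1 - β) • (x + y)‖ ^ 2 ≤ (1 - β) * ‖x‖ ^ 2 + 1 / β * ‖y‖ ^ 2 := by
  rw [norm_smul, mul_pow, Real.norm_eq_abs, sq_abs]
  have h1 : ‖x + y‖ ^ 2 ≤ (‖x‖ + ‖y‖) ^ 2 := by gcongr; exact norm_add_le x y
  have h2 : (1 - β) ^ 2 * ‖x + y‖ ^ 2 ≤ (1 - β) ^ 2 * (‖x‖ + ‖y‖) ^ 2 := by gcongr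
  have h3 : (1 - β) * ‖x‖ ^ 2 + 1 / β * ‖y‖ ^ 2 - (1 - β) ^ 2 * (‖x‖ + ‖y‖) ^ 2
      = ((1 - β) * (β * ‖x‖ - (1 - β) * ‖y‖) ^ 2
        + β * (2 - β) * ‖y‖ ^ 2) / β := by
    field_simp
    ring
  have h4 : 0 ≤ ((1 - β) * (β * ‖x‖ - (1 - β) * ‖y‖) ^ 2
        + β * (2 - β) * ‖y‖ ^ 2) / β := by
    have : 0 ≤ 1 - β := by linarith
    have : 0 ≤ 2 - β := by linarith
    positivity
  linarith

/-- The descent lemma. -/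
lemma descent_of_lipschitz_gradient [CompleteSpace E] {f : E → ℝ} {L : ℝ}
    (hf : Differentiable ℝ f) (hL : ∀ x y, ‖gradient f x - gradient f y‖ ≤ L * ‖x - y‖)
    (x d : E) : f (x + d) ≤ f x + inner ℝ (gradient f x) d + L / 2 * ‖d‖ ^ 2 := by
  -- The gap between `f` along the segment and its quadratic upper model, up to the constant `f x`.
  -- The Lipschitz bound makes its derivative nonpositive, so comparing `h 1` with `h 0` gives the
  -- claim.
  let h : ℝ → ℝ := fun t => f (x + t • d) - t * inner ℝ (gradient f x) d - L * t ^ 2 / 2 * ‖d‖ ^ 2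
  have hd : ∀ t, HasDerivAt h (inner ℝ (gradient f (x + t • d)) d - inner ℝ (gradient f x) d
      - L * t * ‖d‖ ^ 2) t := by
    intro t
    have h1 : HasDerivAt (fun t : ℝ => x + t • d) d t := by
      simpa using ((hasDerivAt_id t).smul_const d).const_add x
    have h2 : HasDerivAt (fun t : ℝ => f (x + t • d)) (inner ℝ (gradient f (x + t • d)) d) t := by
      have := (hf (x + t • d)).hasGradientAt.hasFDerivAt.comp_hasDerivAt t h1
      rw [InnerProductSpace.toDual_apply_apply] at this
      exact this
    have h3 : HasDerivAt (fun t : ℝ => t * inner ℝ (gradient f x) d)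
        (inner ℝ (gradient f x) d) t := by
      simpa using (hasDerivAt_id t).mul_const (inner ℝ (gradient f x) d)
    have h4 : HasDerivAt (fun t : ℝ => L * t ^ 2 / 2 * ‖d‖ ^ 2) (L * t * ‖d‖ ^ 2) t := by
      have := (((hasDerivAt_pow 2 t).const_mul L).div_const 2).mul_const (‖d‖ ^ 2)
      exact this.congr_deriv (by push_cast; ring)
    exact (h2.sub h3).sub h4
  have hanti : AntitoneOn h (Set.Icc 0 1) := by
    refine antitoneOn_of_deriv_nonpos (convex_Icc 0 1)
      (fun t _ => (hd t).continuousAt.continuousWithinAt)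
      (fun t _ => (hd t).differentiableAt.differentiableWithinAt) fun t ht => ?_
    rw [interior_Icc] at ht
    rw [(hd t).deriv, ← inner_sub_left]
    have h1 := real_inner_le_norm (gradient f (x + t • d) - gradient f x) d
    have h2 := hL (x + t • d) x
    rw [add_sub_cancel_left, norm_smul, Real.norm_eq_abs, abs_of_pos ht.1] at h2
    nlinarith [mul_le_mul_of_nonneg_right h2 (norm_nonneg d)]
  have := hanti (Set.left_mem_Icc.2 zero_le_one) (Set.right_mem_Icc.2 zero_le_one) zero_le_one
  simp only [h, one_smul, zero_smul, add_zero] at this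
  linarith

end Convexity

/-! ### Summing the recursions over periods -/

lemma sum_range_mul_eq (h : ℕ → ℝ) (τ K : ℕ) :
    ∑ t ∈ Finset.range (K * τ), h t
      = ∑ k ∈ Finset.range K, ∑ j ∈ Finset.range τ, h (k * τ + j) := by
  induction K with
  | zero => simp
  | succ K ih => rw [add_mul, one_mul, Finset.sum_range_add, ih, Finset.sum_range_succ]

/-- In the period starting at `k * τ` only the last index precedes a refresh. -/
lemma sum_ite_dvd_succ (h : ℕ → ℝ) {τ : ℕ} (hτ : 0 < τ) (K : ℕ) :
    ∑ t ∈ Finset.range (K * τ), (if τ ∣ t + 1 then h t else 0)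
      = ∑ k ∈ Finset.range K, h (k * τ + (τ - 1)) := by
  rw [sum_range_mul_eq]
  refine Finset.sum_congr rfl fun k _ => ?_
  rw [Finset.sum_eq_single (τ - 1)]
  · rw [if_pos]
    rw [add_assoc, Nat.sub_add_cancel hτ]
    exact ⟨k + 1, by ring⟩
  · intro j hj hne
    rw [Finset.mem_range] at hj
    rw [if_neg]
    rw [add_assoc, Nat.dvd_add_right (Dvd.intro_left k rfl)]
    intro hd
    have := Nat.le_of_dvd (by omega) hd
    omega
  · intro hn
    exact absurd (Finset.mem_range.2 (by omega)) hn

/-- The error of a leaky recursion with forcing `w`. -/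
lemma leaky_sum_le {β c : ℝ} {u w : ℕ → ℝ}
    (h : ∀ t, u (t + 1) ≤ (1 - β) * u t + w t + c) (n : ℕ) :
    β * ∑ t ∈ Finset.range n, u t + u n ≤ u 0 + ∑ t ∈ Finset.range n, w t + n * c := by
  induction n with
  | zero => simp
  | succ n ih =>
    rw [Finset.sum_range_succ, Finset.sum_range_succ]
    push_cast
    linarith [h n]

lemma sum_mul_partial_sum_le {d : ℕ → ℝ} (hd : ∀ t, 0 ≤ d t) (τ : ℕ) :
    ∑ j ∈ Finset.range τ, (j : ℝ) * ∑ i ∈ Finset.range j, d i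
      ≤ (τ : ℝ) ^ 2 / 2 * ∑ i ∈ Finset.range τ, d i := by
  have hS : 0 ≤ ∑ i ∈ Finset.range τ, d i := Finset.sum_nonneg fun i _ => hd i
  have h1 : ∑ j ∈ Finset.range τ, (j : ℝ) ≤ (τ : ℝ) ^ 2 / 2 := by
    induction τ with
    | zero => simp
    | succ k ih =>
      rw [Finset.sum_range_succ]
      have := ih (Finset.sum_nonneg fun i _ => hd i)
      push_cast
      linarith
  calc ∑ j ∈ Finset.range τ, (j : ℝ) * ∑ i ∈ Finset.range j, d i
      ≤ ∑ j ∈ Finset.range τ, (j : ℝ) * ∑ i ∈ Finset.range τ, d i := by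
        refine Finset.sum_le_sum fun j hj => ?_
        have hj' := (Finset.mem_range.1 hj).le
        gcongr
        · intro i _ _
          exact hd i
    _ ≤ _ := by
        rw [← Finset.sum_mul]
        gcongr

/-- The scalar recursions behind the convergence bound: `g`, `d`, `u` and `v` stand for the
expected squared norms of the gradient, of the displacement, of the error of the momentum within
the current subspace and of the part of the gradient outside it, and `φ` for the expected loss. -/
structure ScalarRecursion (β δ η L s2 : ℝ) (τ : ℕ) (g d u v φ : ℕ → ℝ) : Prop where
  g_nonneg : ∀ t, 0 ≤ g t
  d_nonneg : ∀ t, 0 ≤ d t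
  u_nonneg : ∀ t, 0 ≤ u t
  v_le : ∀ t, v t ≤ g t
  descent : ∀ t, φ (t + 1) ≤ φ t - η / 2 * g t - 3 / (8 * η) * d t + η / 2 * (u t + v t)
  u_zero : u 0 ≤ g 0 + β ^ 2 * s2
  u_succ : ∀ t, u (t + 1) ≤ (1 - β) * (u t + if τ ∣ t + 1 then v t else 0)
    + L ^ 2 / β * d t + β ^ 2 * s2
  v_period : ∀ k j, j < τ → v (k * τ + j) ≤ (1 - δ / 2) * g (k * τ + j)
    + 8 / δ * L ^ 2 * (j * ∑ i ∈ Finset.range j, d (k * τ + i))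
  g_period : ∀ k i j, i < τ → j < τ → g (k * τ + i) ≤ 4 * g (k * τ + j)
    + 4 / 3 * L ^ 2 * τ * ∑ i ∈ Finset.range τ, d (k * τ + i)

namespace ScalarRecursion

variable {β δ η L s2 : ℝ} {τ : ℕ} {g d u v φ : ℕ → ℝ}

lemma ite_v_le (h : ScalarRecursion β δ η L s2 τ g d u v φ) (hβ : 0 < β) (hβ1 : β ≤ 1)
    (t : ℕ) : (1 - β) * (if τ ∣ t + 1 then v t else 0) ≤ if τ ∣ t + 1 then g t else 0 := by
  split_ifs
  · have h1 : (1 - β) * v t ≤ (1 - β) * g t :=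
      mul_le_mul_of_nonneg_left (h.v_le t) (by linarith)
    nlinarith [h.g_nonneg t]
  · simp

/-- Each refresh feeds in at most the gradient at the last index of a period, and zero initial
momentum contributes `g 0`. The noise count is `K * τ + 1` because `u 0` carries one noise term of
its own. -/
lemma sum_u_le (h : ScalarRecursion β δ η L s2 τ g d u v φ) (hβ : 0 < β) (hβ1 : β ≤ 1)
    (hτ : 0 < τ) (K : ℕ) :
    β * ∑ t ∈ Finset.range (K * τ), u t
      ≤ g 0 + ∑ k ∈ Finset.range K, g (k * τ + (τ - 1))
        + L ^ 2 / β * ∑ t ∈ Finset.range (K * τ), d t + (K * τ + 1) * (β ^ 2 * s2) := by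
  have h1 := leaky_sum_le (β := β) (c := β ^ 2 * s2) (u := u)
    (w := fun t => (if τ ∣ t + 1 then g t else 0) + L ^ 2 / β * d t)
    (fun t => by
      have := h.u_succ t
      have := h.ite_v_le hβ hβ1 t
      linarith) (K * τ)
  rw [Finset.sum_add_distrib, sum_ite_dvd_succ _ hτ, ← Finset.mul_sum] at h1
  push_cast at h1
  have := h.u_nonneg (K * τ)
  have := h.u_zero
  linarith

lemma sum_v_le (h : ScalarRecursion β δ η L s2 τ g d u v φ) (hδ : 0 < δ) (K : ℕ) :
    ∑ t ∈ Finset.range (K * τ), v t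
      ≤ (1 - δ / 2) * ∑ t ∈ Finset.range (K * τ), g t
        + 4 * L ^ 2 * τ ^ 2 / δ * ∑ t ∈ Finset.range (K * τ), d t := by
  simp only [sum_range_mul_eq, Finset.mul_sum (Finset.range K), ← Finset.sum_add_distrib]
  refine Finset.sum_le_sum fun k _ => ?_
  calc ∑ j ∈ Finset.range τ, v (k * τ + j)
      ≤ ∑ j ∈ Finset.range τ, ((1 - δ / 2) * g (k * τ + j)
        + 8 / δ * L ^ 2 * (j * ∑ i ∈ Finset.range j, d (k * τ + i))) :=
        Finset.sum_le_sum fun j hj => h.v_period k j (Finset.mem_range.1 hj)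
    _ = (1 - δ / 2) * ∑ j ∈ Finset.range τ, g (k * τ + j) + 8 / δ * L ^ 2 *
        ∑ j ∈ Finset.range τ, (j : ℝ) * ∑ i ∈ Finset.range j, d (k * τ + i) := by
        rw [Finset.sum_add_distrib, Finset.mul_sum, Finset.mul_sum]
    _ ≤ (1 - δ / 2) * ∑ j ∈ Finset.range τ, g (k * τ + j) + 8 / δ * L ^ 2 *
        ((τ : ℝ) ^ 2 / 2 * ∑ i ∈ Finset.range τ, d (k * τ + i)) := by
        gcongr
        exact sum_mul_partial_sum_le (fun t => h.d_nonneg (k * τ + t)) τ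
    _ = _ := by ring

/-- Average the comparison of two gradients of one period over the second index: no single gradient
greatly exceeds the period's mean, up to drift. -/
lemma mul_g_le (h : ScalarRecursion β δ η L s2 τ g d u v φ) (k i : ℕ) (hi : i < τ) :
    τ * g (k * τ + i) ≤ 4 * ∑ j ∈ Finset.range τ, g (k * τ + j)
      + 4 / 3 * L ^ 2 * τ ^ 2 * ∑ i ∈ Finset.range τ, d (k * τ + i) := by
  have := Finset.sum_le_sum fun j (hj : j ∈ Finset.range τ) =>
    h.g_period k i j hi (Finset.mem_range.1 hj)
  rw [Finset.sum_add_distrib, ← Finset.mul_sum] at this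
  simp only [Finset.sum_const, Finset.card_range, nsmul_eq_mul] at this
  linarith

/-- The last gradients of all periods cost `4` times the total and `g 0` costs at most another `4`,
by comparison with its own (first) period. -/
lemma sum_last_le (h : ScalarRecursion β δ η L s2 τ g d u v φ) (hτ : 0 < τ) {K : ℕ}
    (hK : 0 < K) :
    τ * (g 0 + ∑ k ∈ Finset.range K, g (k * τ + (τ - 1)))
      ≤ 8 * ∑ t ∈ Finset.range (K * τ), g t
        + 8 / 3 * L ^ 2 * τ ^ 2 * ∑ t ∈ Finset.range (K * τ), d t := by
  have h1 : τ * ∑ k ∈ Finset.range K, g (k * τ + (τ - 1))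
      ≤ 4 * ∑ t ∈ Finset.range (K * τ), g t
        + 4 / 3 * L ^ 2 * τ ^ 2 * ∑ t ∈ Finset.range (K * τ), d t := by
    simp only [sum_range_mul_eq, Finset.mul_sum (Finset.range K), ← Finset.sum_add_distrib]
    exact Finset.sum_le_sum fun k _ => h.mul_g_le k (τ - 1) (by omega)
  have h2 := h.mul_g_le 0 0 hτ
  simp only [zero_mul, zero_add] at h2
  have hsub : Finset.range τ ⊆ Finset.range (K * τ) :=
    Finset.range_subset_range.2 (Nat.le_mul_of_pos_left τ hK)
  have h3 : ∑ j ∈ Finset.range τ, g j ≤ ∑ t ∈ Finset.range (K * τ), g t :=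
    Finset.sum_le_sum_of_subset_of_nonneg hsub fun i _ _ => h.g_nonneg i
  have h4 : ∑ j ∈ Finset.range τ, d j ≤ ∑ t ∈ Finset.range (K * τ), d t :=
    Finset.sum_le_sum_of_subset_of_nonneg hsub fun i _ _ => h.d_nonneg i
  have h5 : 4 / 3 * L ^ 2 * τ ^ 2 * ∑ j ∈ Finset.range τ, d j
      ≤ 4 / 3 * L ^ 2 * τ ^ 2 * ∑ t ∈ Finset.range (K * τ), d t := by gcongr
  linarith

lemma sum_descent (h : ScalarRecursion β δ η L s2 τ g d u v φ) (n : ℕ) :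
    φ n ≤ φ 0 - η / 2 * ∑ t ∈ Finset.range n, g t - 3 / (8 * η) * ∑ t ∈ Finset.range n, d t
      + η / 2 * (∑ t ∈ Finset.range n, u t + ∑ t ∈ Finset.range n, v t) := by
  induction n with
  | zero => simp
  | succ n ih =>
    simp only [Finset.sum_range_succ]
    linarith [h.descent n]

/-- The convergence bound over `K` periods. -/
theorem average_le (h : ScalarRecursion β δ η L s2 τ g d u v φ) (hβ : 0 < β) (hβ1 : β ≤ 1)
    (hδ : 0 < δ) (hδ1 : δ ≤ 1) (hη : 0 < η) (hs : 0 ≤ s2)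
    (hτ : 64 / (3 * β * δ) ≤ (τ : ℝ)) (h1 : 80 * L ^ 2 * η ^ 2 ≤ 3 * δ * β ^ 2)
    (h2 : 80 * τ ^ 2 * L ^ 2 * η ^ 2 ≤ 3 * δ) (h3 : 16 * τ * L ^ 2 * η ^ 2 ≤ 3 * β)
    {K : ℕ} (hK : 1 ≤ K) {Δ : ℝ} (hφ : φ 0 - φ (K * τ) ≤ Δ) :
    1 / ((K : ℝ) * τ) * ∑ t ∈ Finset.range (K * τ), g t
      ≤ 16 * Δ / (δ * η * K * τ) + 32 * β * s2 / (3 * δ) := by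
  have hτβ : 64 ≤ 3 * β * δ * τ := by
    rw [div_le_iff₀ (by positivity)] at hτ
    linarith
  -- Only needed to absorb the extra noise term: `K τ + 1 ≤ (4/3) K τ`.
  have hτ3 : 3 ≤ (τ : ℝ) := by
    have : β * δ ≤ 1 := mul_le_one₀ hβ1 hδ.le hδ1
    nlinarith [Nat.cast_nonneg (α := ℝ) τ]
  have hτ0 : 0 < τ := by
    rw [← Nat.cast_pos (α := ℝ)]
    linarith
  have hτr : (0 : ℝ) < τ := by linarith
  have hKr : (1 : ℝ) ≤ K := by exact_mod_cast hK
  set A := ∑ t ∈ Finset.range (K * τ), g t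
  set B := ∑ t ∈ Finset.range (K * τ), d t
  set U := ∑ t ∈ Finset.range (K * τ), u t
  set V := ∑ t ∈ Finset.range (K * τ), v t
  set W := g 0 + ∑ k ∈ Finset.range K, g (k * τ + (τ - 1))
  have hA : 0 ≤ A := Finset.sum_nonneg fun t _ => h.g_nonneg t
  have hB : 0 ≤ B := Finset.sum_nonneg fun t _ => h.d_nonneg t
  have eW : W ≤ 8 / τ * A + 8 / 3 * L ^ 2 * τ * B := by
    have : τ * W ≤ 8 * A + 8 / 3 * L ^ 2 * τ ^ 2 * B := h.sum_last_le hτ0 hK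
    rw [← mul_le_mul_iff_right₀ hτr]
    refine this.trans (le_of_eq ?_)
    field_simp
  have eU : U ≤ 1 / β * W + L ^ 2 / β ^ 2 * B + (K * τ + 1) * (β * s2) := by
    have : β * U ≤ W + L ^ 2 / β * B + (K * τ + 1) * (β ^ 2 * s2) := h.sum_u_le hβ hβ1 hτ0 K
    rw [← mul_le_mul_iff_right₀ hβ]
    refine this.trans (le_of_eq ?_)
    field_simp
  have eV : V ≤ (1 - δ / 2) * A + 4 * L ^ 2 * τ ^ 2 / δ * B := h.sum_v_le hδ K
  -- The lower bound on `τ` enters here: the refresh terms use up `3δ/8` of the available `δ/2`,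
  -- leaving `δ/8`.
  have eA : 1 / β * (8 / τ) ≤ 3 / 8 * δ := by
    rw [div_mul_div_comm, div_le_iff₀ (by positivity)]
    linarith
  have eK : (K * τ + 1 : ℝ) ≤ 4 / 3 * (K * τ) := by nlinarith
  -- Each step-size condition controls one displacement coefficient; together `3/80 + 12/80 + 1/2 ≤
  -- 3/4`.
  have b1 : L ^ 2 / β ^ 2 * η ^ 2 ≤ 3 / 80 := by
    rw [div_mul_eq_mul_div, div_le_iff₀ (by positivity)]
    nlinarith [sq_nonneg β]
  have b2 : 4 * L ^ 2 * τ ^ 2 / δ * η ^ 2 ≤ 12 / 80 := by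
    rw [div_mul_eq_mul_div, div_le_iff₀ (by positivity)]
    linarith
  have b3 : 1 / β * (8 / 3 * L ^ 2 * τ) * η ^ 2 ≤ 1 / 2 := by
    rw [one_div_mul_eq_div, div_mul_eq_mul_div, div_le_iff₀ hβ]
    linarith
  have eB : L ^ 2 / β ^ 2 + 4 * L ^ 2 * τ ^ 2 / δ + 1 / β * (8 / 3 * L ^ 2 * τ)
      ≤ 3 / (4 * η ^ 2) := by
    rw [le_div_iff₀ (by positivity)]
    linarith
  have eUV : U + V ≤ (1 - δ / 8) * A + 3 / (4 * η ^ 2) * B + 4 / 3 * (K * τ) * (β * s2) := by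
    have i1 : 1 / β * W ≤ 1 / β * (8 / τ * A + 8 / 3 * L ^ 2 * τ * B) := by gcongr
    have i2 : 1 / β * (8 / τ) * A ≤ 3 / 8 * δ * A := by gcongr
    have i3 : (L ^ 2 / β ^ 2 + 4 * L ^ 2 * τ ^ 2 / δ + 1 / β * (8 / 3 * L ^ 2 * τ)) * B
      ≤ 3 / (4 * η ^ 2) * B := by gcongr
    have i4 : (K * τ + 1) * (β * s2) ≤ 4 / 3 * (K * τ) * (β * s2) := by gcongr
    linarith
  have hsum := h.sum_descent (K * τ)
  have hfin : η / 2 * (δ / 8 * A) ≤ Δ + η / 2 * (4 / 3 * (K * τ) * (β * s2)) := by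
    have i1 : η / 2 * (U + V) ≤ η / 2 * ((1 - δ / 8) * A + 3 / (4 * η ^ 2) * B
      + 4 / 3 * (K * τ) * (β * s2)) := by gcongr
    -- The constant `3/4` is the one for which the displacement term cancels exactly against the one
    -- gained in the descent inequality.
    have i2 : η / 2 * (3 / (4 * η ^ 2) * B) = 3 / (8 * η) * B := by
      field_simp
      ring
    linarith
  have hKτ : (0 : ℝ) < K * τ := by positivity
  rw [one_div_mul_eq_div, div_le_iff₀ hKτ]
  have e1 : (16 * Δ / (δ * η * K * τ) + 32 * β * s2 / (3 * δ)) * (K * τ)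
      = (Δ + η / 2 * (4 / 3 * (K * τ) * (β * s2))) * (16 / (δ * η)) := by
    field_simp
    ring
  have e2 : A = η / 2 * (δ / 8 * A) * (16 / (δ * η)) := by
    field_simp
    ring
  rw [e1, e2]
  gcongr

end ScalarRecursion

/-! ### Stochastic gradient descent with projected momentum -/

set_option linter.unusedSectionVars false

section ProjectedMomentum

variable {E Ω : Type*} [NormedAddCommGroup E] [InnerProductSpace ℝ E] [CompleteSpace E]
  [MeasurableSpace E] [BorelSpace E] [SecondCountableTopology E] [MeasurableSpace Ω]

/-- A process `x` driven by the momentum `M (t + 1) = A t ((1 - β) M t + β (∇f (x t) + ν t))`,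
where `A t` is a random orthogonal projection that is refreshed every `τ` steps and `ν` is
centred noise. -/
structure ProjectedMomentum (μ : Measure Ω) (f : E → ℝ) (L β η δ s2 : ℝ) (τ : ℕ) (x₀ : E)
    (x M ν : ℕ → Ω → E) (A : ℕ → Ω → E →ₗ[ℝ] E) : Prop where
  period_pos : 0 < τ
  differentiable : Differentiable ℝ f
  lipschitz : ∀ y z, ‖gradient f y - gradient f z‖ ≤ L * ‖y - z‖
  bddBelow : BddBelow (Set.range f)
  measurable_x : ∀ t, Measurable (x t)
  measurable_M : ∀ t, Measurable (M t)
  measurable_A : ∀ t (w : Ω → E), Measurable w → Measurable fun ω => A t ω (w ω)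
  proj : ∀ᵐ ω ∂μ, ∀ t, (A t ω).IsSymmetricProjection
  held : ∀ k j ω, j < τ → A (k * τ + j) ω = A (k * τ) ω
  x_zero : ∀ ω, x 0 ω = x₀
  x_succ : ∀ t ω, x (t + 1) ω = x t ω - η • M (t + 1) ω
  M_zero : ∀ ω, M 0 ω = 0
  M_succ : ∀ᵐ ω ∂μ, ∀ t, M (t + 1) ω
    = A t ω ((1 - β) • M t ω + β • (gradient f (x t ω) + ν t ω))
  memLp_noise : ∀ t, MemLp (ν t) 2 μ
  noise_sq_le : ∀ t, ∫ ω, ‖ν t ω‖ ^ 2 ∂μ ≤ s2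
  noise_orthogonal : ∀ t, MemLp (fun ω => A t ω (M t ω - gradient f (x t ω))) 2 μ →
    ∫ ω, inner ℝ (A t ω (M t ω - gradient f (x t ω))) (ν t ω) ∂μ = 0
  energy_le : ∀ k, MemLp (fun ω => gradient f (x (k * τ) ω)) 2 μ →
    δ * ∫ ω, ‖gradient f (x (k * τ) ω)‖ ^ 2 ∂μ
      ≤ ∫ ω, ‖A (k * τ) ω (gradient f (x (k * τ) ω))‖ ^ 2 ∂μ

lemma integrable_norm_sq {μ : Measure Ω} {Z : Ω → E} (hZ : MemLp Z 2 μ) :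
    Integrable (fun ω => ‖Z ω‖ ^ 2) μ :=
  (memLp_two_iff_integrable_sq_norm hZ.1).1 hZ

lemma integrable_inner_of_memLp {μ : Measure Ω} {Y Z : Ω → E} (hY : MemLp Y 2 μ)
    (hZ : MemLp Z 2 μ) : Integrable (fun ω => inner ℝ (Y ω) (Z ω)) μ :=
  (hY.norm.integrable_mul hZ.norm).mono' (hY.1.inner hZ.1)
    (Filter.Eventually.of_forall fun _ => norm_inner_le_norm _ _)

/-- Telescope, then apply Cauchy–Schwarz. -/
lemma norm_sum_range_sq_le (y : ℕ → E) (a j : ℕ) :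
    ‖y (a + j) - y a‖ ^ 2 ≤ j * ∑ i ∈ Finset.range j, ‖y (a + i + 1) - y (a + i)‖ ^ 2 := by
  have h : y (a + j) - y a = ∑ i ∈ Finset.range j, (y (a + i + 1) - y (a + i)) := by
    exact (Finset.sum_range_sub (fun i => y (a + i)) j).symm
  rw [h]
  calc ‖∑ i ∈ Finset.range j, (y (a + i + 1) - y (a + i))‖ ^ 2
      ≤ (∑ i ∈ Finset.range j, ‖y (a + i + 1) - y (a + i)‖) ^ 2 := by
        gcongr
        exact norm_sum_le _ _
    _ ≤ _ := by simpa using sq_sum_le_card_mul_sum_sq (s := Finset.range j)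
                  (f := fun i => ‖y (a + i + 1) - y (a + i)‖)

lemma continuous_gradient_of_lipschitz {f : E → ℝ} {L : ℝ}
    (hL : ∀ y z, ‖gradient f y - gradient f z‖ ≤ L * ‖y - z‖) : Continuous (gradient f) :=
  (LipschitzWith.of_dist_le_mul (K := L.toNNReal) fun y z => by
    rw [dist_eq_norm, dist_eq_norm]
    refine (hL y z).trans ?_
    gcongr
    exact Real.le_coe_toNNReal L).continuous

lemma integral_le_linear_combination {μ : Measure Ω} {X Y Z : Ω → ℝ} (hX : Integrable X μ)
    (hY : Integrable Y μ) (hZ : Integrable Z μ) (a b : ℝ)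
    (h : ∀ᵐ ω ∂μ, X ω ≤ a * Y ω + b * Z ω) :
    ∫ ω, X ω ∂μ ≤ a * ∫ ω, Y ω ∂μ + b * ∫ ω, Z ω ∂μ := by
  rw [← integral_const_mul, ← integral_const_mul,
    ← integral_add (hY.const_mul _) (hZ.const_mul _)]
  exact integral_mono_ae hX ((hY.const_mul _).add (hZ.const_mul _)) h

namespace ProjectedMomentum

variable {μ : Measure Ω} [IsProbabilityMeasure μ] {f : E → ℝ} {L β η δ s2 : ℝ} {τ : ℕ} {x₀ : E}
  {x M ν : ℕ → Ω → E} {A : ℕ → Ω → E →ₗ[ℝ] E}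

section

variable (h : ProjectedMomentum μ f L β η δ s2 τ x₀ x M ν A)
include h

lemma measurable_gradient : Measurable (gradient f) :=
  (continuous_gradient_of_lipschitz h.lipschitz).measurable

lemma memLp_gradient_sub (y z : Ω → E) (hy : Measurable y) (hz : Measurable z)
    (hyz : MemLp (fun ω => y ω - z ω) 2 μ) :
    MemLp (fun ω => gradient f (y ω) - gradient f (z ω)) 2 μ :=
  hyz.of_le_mul (c := L) ((h.measurable_gradient.comp hy).sub
    (h.measurable_gradient.comp hz)).aestronglyMeasurable
    (Filter.Eventually.of_forall fun _ => h.lipschitz _ _)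

lemma memLp_apply (t : ℕ) {w : Ω → E} (hm : Measurable w) (hw : MemLp w 2 μ) :
    MemLp (fun ω => A t ω (w ω)) 2 μ :=
  hw.of_le (h.measurable_A t w hm).aestronglyMeasurable
    (h.proj.mono fun _ hω => (hω t).norm_apply_le _)

lemma memLp_gradient_of_x {t : ℕ} (hx : MemLp (x t) 2 μ) :
    MemLp (fun ω => gradient f (x t ω)) 2 μ := by
  have h1 := h.memLp_gradient_sub (x t) (fun _ => x₀) (h.measurable_x t) measurable_const
    (hx.sub (memLp_const x₀))
  have h2 := h1.add (memLp_const (gradient f x₀))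
  exact h2.ae_eq (Filter.Eventually.of_forall fun ω => by simp)

/-- Each step is built from square-integrable terms: the gradient grows at most linearly in `x`, and
projections do not increase norms. This supplies the integrability that `noise_orthogonal` and
`energy_le` ask for. -/
lemma memLp_x_M (t : ℕ) : MemLp (x t) 2 μ ∧ MemLp (M t) 2 μ := by
  induction t with
  | zero =>
    have e1 : x 0 = fun _ => x₀ := funext h.x_zero
    have e2 : M 0 = fun _ => 0 := funext h.M_zero
    rw [e1, e2]
    exact ⟨memLp_const _, memLp_const _⟩
  | succ t ih =>
    have hg := h.memLp_gradient_of_x ih.1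
    have hw : MemLp (fun ω => (1 - β) • M t ω + β • (gradient f (x t ω) + ν t ω)) 2 μ :=
      (ih.2.const_smul (1 - β)).add ((hg.add (h.memLp_noise t)).const_smul β)
    have hM : MemLp (M (t + 1)) 2 μ :=
      hw.of_le (h.measurable_M _).aestronglyMeasurable (by
        filter_upwards [h.proj, h.M_succ] with ω h1 h2
        rw [h2 t]
        exact (h1 t).norm_apply_le _)
    refine ⟨?_, hM⟩
    have : x (t + 1) = fun ω => x t ω - η • M (t + 1) ω := funext (h.x_succ t)
    rw [this]
    exact ih.1.sub (hM.const_smul η)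

lemma memLp_gradient (t : ℕ) : MemLp (fun ω => gradient f (x t ω)) 2 μ :=
  h.memLp_gradient_of_x (h.memLp_x_M t).1

lemma measurable_gradient_x (t : ℕ) : Measurable fun ω => gradient f (x t ω) :=
  h.measurable_gradient.comp (h.measurable_x t)

lemma memLp_apply_gradient (s t : ℕ) : MemLp (fun ω => A s ω (gradient f (x t ω))) 2 μ :=
  h.memLp_apply s (h.measurable_gradient_x t) (h.memLp_gradient t)

lemma apply_M_succ : ∀ᵐ ω ∂μ, ∀ t, A t ω (M (t + 1) ω) = M (t + 1) ω := by
  filter_upwards [h.proj, h.M_succ] with ω h1 h2 t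
  rw [h2 t, (h1 t).apply_apply]

lemma held_of_not_dvd {t : ℕ} (ht : ¬ τ ∣ t + 1) (ω : Ω) : A (t + 1) ω = A t ω := by
  have hτ := h.period_pos
  have h1 : (t + 1) % τ ≠ 0 := fun h0 => ht (Nat.dvd_of_mod_eq_zero h0)
  have h2 : (t + 1) % τ < τ := Nat.mod_lt _ hτ
  have e1 := h.held ((t + 1) / τ) ((t + 1) % τ) ω h2
  have e2 := h.held ((t + 1) / τ) ((t + 1) % τ - 1) ω (by omega)
  have e3 := Nat.div_add_mod' (t + 1) τ
  rw [e3] at e1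
  have e4 : (t + 1) / τ * τ + ((t + 1) % τ - 1) = t := by omega
  rw [e4] at e2
  rw [e1, e2]

/-- The noise enters the error of the momentum with weight `β²`. -/
lemma error_le (t : ℕ) :
    ∫ ω, ‖M (t + 1) ω - A t ω (gradient f (x t ω))‖ ^ 2 ∂μ
      ≤ ∫ ω, ‖(1 - β) • A t ω (M t ω - gradient f (x t ω))‖ ^ 2 ∂μ + β ^ 2 * s2 := by
  have hw : MemLp (fun ω => M t ω - gradient f (x t ω)) 2 μ :=
    (h.memLp_x_M t).2.sub (h.memLp_gradient t)
  have hAw : MemLp (fun ω => A t ω (M t ω - gradient f (x t ω))) 2 μ :=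
    h.memLp_apply t ((h.measurable_M t).sub (h.measurable_gradient_x t)) hw
  have i1 : Integrable (fun ω => ‖(1 - β) • A t ω (M t ω - gradient f (x t ω))‖ ^ 2) μ :=
    integrable_norm_sq (hAw.const_smul (1 - β))
  have i2 : Integrable (fun ω => inner ℝ (A t ω (M t ω - gradient f (x t ω))) (ν t ω)) μ :=
    integrable_inner_of_memLp hAw (h.memLp_noise t)
  have i3 := integrable_norm_sq (h.memLp_noise t)
  have i4 : Integrable (fun ω => ‖(1 - β) • A t ω (M t ω - gradient f (x t ω))‖ ^ 2
      + 2 * (1 - β) * β * inner ℝ (A t ω (M t ω - gradient f (x t ω))) (ν t ω)) μ :=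
    i1.add (i2.const_mul _)
  have hpt : ∀ᵐ ω ∂μ, ‖M (t + 1) ω - A t ω (gradient f (x t ω))‖ ^ 2
      ≤ ‖(1 - β) • A t ω (M t ω - gradient f (x t ω))‖ ^ 2
        + 2 * (1 - β) * β * inner ℝ (A t ω (M t ω - gradient f (x t ω))) (ν t ω)
        + β ^ 2 * ‖ν t ω‖ ^ 2 := by
    filter_upwards [h.proj, h.M_succ] with ω h1 h2
    -- Everything is under the same projection `A t`, so the error splits into an old part and a
    -- noise part.
    have e : M (t + 1) ω - A t ω (gradient f (x t ω))
        = (1 - β) • A t ω (M t ω - gradient f (x t ω)) + β • A t ω (ν t ω) := by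
      rw [h2 t, ← map_sub, ← map_smul, ← map_smul, ← map_add]
      congr 1
      module
    -- Symmetry and idempotence turn `⟪A w, A ν⟫` into `⟪A w, ν⟫`, the form whose expectation
    -- vanishes.
    rw [e, norm_add_sq_real, real_inner_smul_left, real_inner_smul_right, ← (h1 t).isSymmetric,
      (h1 t).apply_apply, norm_smul β, mul_pow, Real.norm_eq_abs β, sq_abs]
    have h3 : ‖A t ω (ν t ω)‖ ^ 2 ≤ ‖ν t ω‖ ^ 2 := by
      gcongr
      exact (h1 t).norm_apply_le _
    nlinarith [mul_le_mul_of_nonneg_left h3 (sq_nonneg β)]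
  calc _ ≤ ∫ ω, (‖(1 - β) • A t ω (M t ω - gradient f (x t ω))‖ ^ 2
        + 2 * (1 - β) * β * inner ℝ (A t ω (M t ω - gradient f (x t ω))) (ν t ω)
        + β ^ 2 * ‖ν t ω‖ ^ 2) ∂μ :=
        integral_mono_of_nonneg (Filter.Eventually.of_forall fun _ => by positivity)
          (i4.add (i3.const_mul _)) hpt
    _ = ∫ ω, ‖(1 - β) • A t ω (M t ω - gradient f (x t ω))‖ ^ 2 ∂μ
        + β ^ 2 * ∫ ω, ‖ν t ω‖ ^ 2 ∂μ := by
        rw [integral_add i4 (i3.const_mul _),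
          integral_add i1 (i2.const_mul _), integral_const_mul, integral_const_mul,
          h.noise_orthogonal t hAw]
        simp
    _ ≤ _ := by
        gcongr
        exact h.noise_sq_le t

lemma error_zero_le (hβ : 0 ≤ β) (hβ1 : β ≤ 1) :
    ∫ ω, ‖M 1 ω - A 0 ω (gradient f (x 0 ω))‖ ^ 2 ∂μ
      ≤ ∫ ω, ‖gradient f (x 0 ω)‖ ^ 2 ∂μ + β ^ 2 * s2 := by
  refine (h.error_le 0).trans (add_le_add_left ?_ _)
  refine integral_mono_of_nonneg (Filter.Eventually.of_forall fun _ => by positivity)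
    (integrable_norm_sq (h.memLp_gradient 0)) ?_
  filter_upwards [h.proj] with ω h1
  rw [h.M_zero, zero_sub, map_neg, smul_neg, norm_neg, norm_smul, Real.norm_eq_abs,
    abs_of_nonneg (by linarith)]
  gcongr
  calc (1 - β) * ‖A 0 ω (gradient f (x 0 ω))‖ ≤ 1 * ‖gradient f (x 0 ω)‖ := by
        gcongr
        · linarith
        · exact (h1 0).norm_apply_le _
    _ = _ := one_mul _

lemma memLp_dx (t : ℕ) : MemLp (fun ω => x (t + 1) ω - x t ω) 2 μ :=
  (h.memLp_x_M (t + 1)).1.sub (h.memLp_x_M t).1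

lemma memLp_error (t : ℕ) : MemLp (fun ω => M (t + 1) ω - A t ω (gradient f (x t ω))) 2 μ :=
  (h.memLp_x_M (t + 1)).2.sub (h.memLp_apply_gradient t t)

lemma memLp_residual (s t : ℕ) :
    MemLp (fun ω => gradient f (x t ω) - A s ω (gradient f (x t ω))) 2 μ :=
  (h.memLp_gradient t).sub (h.memLp_apply_gradient s t)

/-- Split off the gradient change, which Young's inequality charges to the displacement at rate
`1/β`. If the projection is kept, the remaining term is the old in-subspace error; if it is redrawn,
the new subspace sees at most the full `‖M - ∇f‖²`, which is the old error plus the old residual. -/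
lemma error_succ_le (hβ : 0 < β) (hβ1 : β ≤ 1) (t : ℕ) :
    ∫ ω, ‖M (t + 1 + 1) ω - A (t + 1) ω (gradient f (x (t + 1) ω))‖ ^ 2 ∂μ
      ≤ (1 - β) * (∫ ω, ‖M (t + 1) ω - A t ω (gradient f (x t ω))‖ ^ 2 ∂μ
          + if τ ∣ t + 1 then
            ∫ ω, ‖gradient f (x t ω) - A t ω (gradient f (x t ω))‖ ^ 2 ∂μ else 0)
        + L ^ 2 / β * ∫ ω, ‖x (t + 1) ω - x t ω‖ ^ 2 ∂μ + β ^ 2 * s2 := by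
  refine (h.error_le (t + 1)).trans ?_
  refine add_le_add_left ?_ _
  have i1 := integrable_norm_sq (h.memLp_error t)
  have i2 := integrable_norm_sq (h.memLp_residual t t)
  have i3 := integrable_norm_sq (h.memLp_dx t)
  have i4 : Integrable (fun ω => if τ ∣ t + 1 then
      ‖gradient f (x t ω) - A t ω (gradient f (x t ω))‖ ^ 2 else 0) μ := by
    split_ifs
    · exact i2
    · exact integrable_zero _ _ _
  have e : (if τ ∣ t + 1 then
      ∫ ω, ‖gradient f (x t ω) - A t ω (gradient f (x t ω))‖ ^ 2 ∂μ else 0)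
      = ∫ ω, (if τ ∣ t + 1 then
      ‖gradient f (x t ω) - A t ω (gradient f (x t ω))‖ ^ 2 else 0) ∂μ := by
    split_ifs <;> simp
  have i5 := integrable_norm_sq ((h.memLp_apply (t + 1) ((h.measurable_M (t + 1)).sub
    (h.measurable_gradient_x (t + 1))) ((h.memLp_x_M (t + 1)).2.sub
      (h.memLp_gradient (t + 1)))).const_smul (1 - β))
  rw [e, ← integral_add i1 i4]
  refine integral_le_linear_combination i5 (i1.add i4) i3 _ _ ?_
  filter_upwards [h.proj, h.apply_M_succ] with ω h1 h2
  have hd : A (t + 1) ω (M (t + 1) ω - gradient f (x (t + 1) ω))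
      = A (t + 1) ω (M (t + 1) ω - gradient f (x t ω))
        + A (t + 1) ω (gradient f (x t ω) - gradient f (x (t + 1) ω)) := by
    rw [← map_add]
    congr 1
    abel
  have hlip : ‖A (t + 1) ω (gradient f (x t ω) - gradient f (x (t + 1) ω))‖ ^ 2
      ≤ L ^ 2 * ‖x (t + 1) ω - x t ω‖ ^ 2 := by
    rw [← mul_pow, norm_sub_rev (x (t + 1) ω)]
    gcongr
    exact ((h1 (t + 1)).norm_apply_le _).trans (h.lipschitz _ _)
  have hmain : ‖A (t + 1) ω (M (t + 1) ω - gradient f (x t ω))‖ ^ 2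
      ≤ ‖M (t + 1) ω - A t ω (gradient f (x t ω))‖ ^ 2 + if τ ∣ t + 1 then
        ‖gradient f (x t ω) - A t ω (gradient f (x t ω))‖ ^ 2 else 0 := by
    split_ifs with hdvd
    · rw [← (h1 t).norm_sub_sq (h2 t)]
      gcongr
      exact (h1 (t + 1)).norm_apply_le _
    · rw [h.held_of_not_dvd hdvd, map_sub, h2 t, add_zero]
  simp only [Pi.smul_apply, Pi.sub_apply, Pi.add_apply]
  rw [hd]
  refine (norm_smul_add_sq_le hβ hβ1 _ _).trans ?_
  have hβ' : 0 ≤ 1 - β := by linarith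
  calc _ ≤ (1 - β) * (‖M (t + 1) ω - A t ω (gradient f (x t ω))‖ ^ 2 + if τ ∣ t + 1 then
        ‖gradient f (x t ω) - A t ω (gradient f (x t ω))‖ ^ 2 else 0)
        + 1 / β * (L ^ 2 * ‖x (t + 1) ω - x t ω‖ ^ 2) := by gcongr
    _ = _ := by ring

/-- The loss is squeezed between a lower bound of `f` and the quadratic upper bound at `x₀` from the
descent lemma. -/
lemma integrable_loss (t : ℕ) : Integrable (fun ω => f (x t ω)) μ := by
  obtain ⟨c, hc⟩ := h.bddBelow
  have hdx : MemLp (fun ω => x t ω - x₀) 2 μ := (h.memLp_x_M t).1.sub (memLp_const x₀)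
  have hup : Integrable (fun ω => f x₀ + inner ℝ (gradient f x₀) (x t ω - x₀)
      + L / 2 * ‖x t ω - x₀‖ ^ 2) μ :=
    ((integrable_const _).add ((hdx.integrable one_le_two).const_inner _)).add
      ((integrable_norm_sq hdx).const_mul _)
  refine (hup.norm.add (integrable_const |c|)).mono'
    (h.differentiable.continuous.measurable.comp (h.measurable_x t)).aestronglyMeasurable
    (Filter.Eventually.of_forall fun ω => ?_)
  have h1 := descent_of_lipschitz_gradient h.differentiable h.lipschitz x₀ (x t ω - x₀)
  rw [add_sub_cancel] at h1
  have h2 : c ≤ f (x t ω) := hc ⟨_, rfl⟩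
  simp only [Pi.add_apply, Real.norm_eq_abs]
  rw [abs_le]
  constructor
  · linarith [neg_abs_le c, abs_nonneg (f x₀ + inner ℝ (gradient f x₀) (x t ω - x₀)
      + L / 2 * ‖x t ω - x₀‖ ^ 2)]
  · linarith [abs_nonneg c, le_abs_self (f x₀ + inner ℝ (gradient f x₀) (x t ω - x₀)
      + L / 2 * ‖x t ω - x₀‖ ^ 2)]

/-- Polarization turns `-η⟪∇f, M⟫` into `(η/2)(‖M - ∇f‖² - ‖∇f‖² - ‖M‖²)`. The smoothness term takes
at most `(η/8)‖M‖²` because `L η ≤ 1/4`, leaving `(3η/8)‖M‖²`, that is `3/(8η)` times the squared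
displacement. -/
lemma loss_succ_le (hL : 0 < L) (hη : 0 < η) (hηL : η ≤ 1 / (4 * L)) (t : ℕ) :
    ∫ ω, f (x (t + 1) ω) ∂μ ≤ ∫ ω, f (x t ω) ∂μ
      - η / 2 * ∫ ω, ‖gradient f (x t ω)‖ ^ 2 ∂μ
      - 3 / (8 * η) * ∫ ω, ‖x (t + 1) ω - x t ω‖ ^ 2 ∂μ
      + η / 2 * (∫ ω, ‖M (t + 1) ω - A t ω (gradient f (x t ω))‖ ^ 2 ∂μ
        + ∫ ω, ‖gradient f (x t ω) - A t ω (gradient f (x t ω))‖ ^ 2 ∂μ) := by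
  have i0 := h.integrable_loss t
  have i1 := integrable_norm_sq (h.memLp_error t)
  have i2 := integrable_norm_sq (h.memLp_residual t t)
  have i3 := integrable_norm_sq (h.memLp_dx t)
  have i4 := integrable_norm_sq (h.memLp_gradient t)
  have key : ∫ ω, (f (x (t + 1) ω) - f (x t ω)) ∂μ
      ≤ η / 2 * ∫ ω, ((‖M (t + 1) ω - A t ω (gradient f (x t ω))‖ ^ 2
        + ‖gradient f (x t ω) - A t ω (gradient f (x t ω))‖ ^ 2)
        - ‖gradient f (x t ω)‖ ^ 2) ∂μ
        + -(3 / (8 * η)) * ∫ ω, ‖x (t + 1) ω - x t ω‖ ^ 2 ∂μ := by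
    refine integral_le_linear_combination ((h.integrable_loss _).sub i0) ((i1.add i2).sub i4) i3
      _ _ ?_
    filter_upwards [h.proj, h.apply_M_succ] with ω h1 h2
    simp only [Pi.add_apply, Pi.sub_apply]
    rw [← (h1 t).norm_sub_sq (h2 t)]
    have hd := descent_of_lipschitz_gradient h.differentiable h.lipschitz (x t ω)
      (x (t + 1) ω - x t ω)
    rw [add_sub_cancel] at hd
    have ex : x (t + 1) ω - x t ω = -(η • M (t + 1) ω) := by
      rw [h.x_succ]
      abel
    rw [norm_sub_rev (M (t + 1) ω), norm_sub_sq_real]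
    rw [ex, inner_neg_right, real_inner_smul_right, norm_neg, norm_smul, Real.norm_eq_abs,
      abs_of_pos hη, mul_pow] at hd
    rw [ex, norm_neg, norm_smul, Real.norm_eq_abs, abs_of_pos hη, mul_pow]
    have e1 : 3 / (8 * η) * (η ^ 2 * ‖M (t + 1) ω‖ ^ 2) = 3 / 8 * η * ‖M (t + 1) ω‖ ^ 2 := by
      field_simp
    have e2 : L * η ≤ 1 / 4 := by
      rw [le_div_iff₀ (by positivity)] at hηL
      linarith
    have e3 : L / 2 * (η ^ 2 * ‖M (t + 1) ω‖ ^ 2) ≤ η / 8 * ‖M (t + 1) ω‖ ^ 2 := by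
      have : L * η * (η * ‖M (t + 1) ω‖ ^ 2) ≤ 1 / 4 * (η * ‖M (t + 1) ω‖ ^ 2) := by gcongr
      linarith
    rw [neg_mul, e1]
    linarith
  have i5 : Integrable (fun ω => ‖M (t + 1) ω - A t ω (gradient f (x t ω))‖ ^ 2
      + ‖gradient f (x t ω) - A t ω (gradient f (x t ω))‖ ^ 2) μ := i1.add i2
  rw [integral_sub (h.integrable_loss _) i0, integral_sub i5 i4, integral_add i1 i2] at key
  linarith

lemma residual_le (t : ℕ) :
    ∫ ω, ‖gradient f (x t ω) - A t ω (gradient f (x t ω))‖ ^ 2 ∂μ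
      ≤ ∫ ω, ‖gradient f (x t ω)‖ ^ 2 ∂μ := by
  refine integral_mono_ae (integrable_norm_sq (h.memLp_residual t t))
    (integrable_norm_sq (h.memLp_gradient t)) ?_
  filter_upwards [h.proj] with ω h1
  gcongr
  exact (h1 t).norm_sub_apply_le _

/-- By Pythagoras the residual is the energy that the freshly drawn projection loses. -/
lemma residual_start_le (k : ℕ) :
    ∫ ω, ‖gradient f (x (k * τ) ω) - A (k * τ) ω (gradient f (x (k * τ) ω))‖ ^ 2 ∂μ
      ≤ (1 - δ) * ∫ ω, ‖gradient f (x (k * τ) ω)‖ ^ 2 ∂μ := by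
  have i1 := integrable_norm_sq (h.memLp_gradient (k * τ))
  have i2 := integrable_norm_sq (h.memLp_apply_gradient (k * τ) (k * τ))
  have e : ∫ ω, ‖gradient f (x (k * τ) ω) - A (k * τ) ω (gradient f (x (k * τ) ω))‖ ^ 2 ∂μ
      = ∫ ω, (‖gradient f (x (k * τ) ω)‖ ^ 2
        - ‖A (k * τ) ω (gradient f (x (k * τ) ω))‖ ^ 2) ∂μ := by
    refine integral_congr_ae ?_
    filter_upwards [h.proj] with ω h1
    linarith [(h1 (k * τ)).norm_sq_add (gradient f (x (k * τ) ω))]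
  rw [e, integral_sub i1 i2]
  linarith [h.energy_le k (h.memLp_gradient _)]

lemma memLp_gradient_dist (s t : ℕ) :
    MemLp (fun ω => gradient f (x t ω) - gradient f (x s ω)) 2 μ :=
  (h.memLp_gradient t).sub (h.memLp_gradient s)

/-- The change of the gradient over `j` steps. -/
lemma gradient_dist_le (a j : ℕ) :
    ∫ ω, ‖gradient f (x (a + j) ω) - gradient f (x a ω)‖ ^ 2 ∂μ
      ≤ L ^ 2 * (j * ∑ i ∈ Finset.range j, ∫ ω, ‖x (a + i + 1) ω - x (a + i) ω‖ ^ 2 ∂μ) := by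
  have i : ∀ i ∈ Finset.range j, Integrable (fun ω => ‖x (a + i + 1) ω - x (a + i) ω‖ ^ 2) μ :=
    fun i _ => integrable_norm_sq (h.memLp_dx (a + i))
  rw [← integral_finsetSum _ i, ← integral_const_mul, ← integral_const_mul]
  refine integral_mono_ae (integrable_norm_sq (h.memLp_gradient_dist _ _))
    (((integrable_finsetSum _ i).const_mul _).const_mul _)
    (Filter.Eventually.of_forall fun ω => ?_)
  calc ‖gradient f (x (a + j) ω) - gradient f (x a ω)‖ ^ 2
      ≤ (L * ‖x (a + j) ω - x a ω‖) ^ 2 := by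
        gcongr
        exact h.lipschitz _ _
    _ = L ^ 2 * ‖x (a + j) ω - x a ω‖ ^ 2 := mul_pow _ _ _
    _ ≤ _ := mul_le_mul_of_nonneg_left (norm_sum_range_sq_le (fun t => x t ω) a j) (sq_nonneg L)

lemma gradient_compare {c : ℝ} (hc : 0 < c) (s t : ℕ) :
    ∫ ω, ‖gradient f (x s ω)‖ ^ 2 ∂μ ≤ (1 + c) * ∫ ω, ‖gradient f (x t ω)‖ ^ 2 ∂μ
      + (1 + 1 / c) * ∫ ω, ‖gradient f (x s ω) - gradient f (x t ω)‖ ^ 2 ∂μ := by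
  have i1 := integrable_norm_sq (h.memLp_gradient t)
  have i2 := integrable_norm_sq (h.memLp_gradient_dist t s)
  refine integral_le_linear_combination (integrable_norm_sq (h.memLp_gradient s)) i1 i2 _ _
    (Filter.Eventually.of_forall fun ω => ?_)
  simpa using norm_add_sq_le_weighted hc (gradient f (x t ω))
    (gradient f (x s ω) - gradient f (x t ω))

lemma residual_compare {c : ℝ} (hc : 0 < c) (s t : ℕ) (hst : ∀ ω, A t ω = A s ω) :
    ∫ ω, ‖gradient f (x t ω) - A t ω (gradient f (x t ω))‖ ^ 2 ∂μ
      ≤ (1 + c) * ∫ ω, ‖gradient f (x s ω) - A s ω (gradient f (x s ω))‖ ^ 2 ∂μ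
      + (1 + 1 / c) * ∫ ω, ‖gradient f (x t ω) - gradient f (x s ω)‖ ^ 2 ∂μ := by
  have i1 := integrable_norm_sq (h.memLp_residual s s)
  have i2 := integrable_norm_sq (h.memLp_gradient_dist s t)
  refine integral_le_linear_combination (integrable_norm_sq (h.memLp_residual t t)) i1 i2 _ _ ?_
  filter_upwards [h.proj] with ω h1
  have e : gradient f (x t ω) - A t ω (gradient f (x t ω))
      = (gradient f (x s ω) - A s ω (gradient f (x s ω)))
        + ((gradient f (x t ω) - gradient f (x s ω))
          - A s ω (gradient f (x t ω) - gradient f (x s ω))) := by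
    rw [hst, map_sub]
    abel
  rw [e]
  refine (norm_add_sq_le_weighted hc _ _).trans ?_
  gcongr
  exact (h1 s).norm_sub_apply_le _

/-- The energy estimate is available only at the start of a period, so go back to the start under
the same projection, lose the factor `1 - δ` there, and return to the current gradient. -/
lemma residual_period_le (hδ : 0 < δ) (hδ1 : δ ≤ 1) (k j : ℕ) (hj : j < τ) :
    ∫ ω, ‖gradient f (x (k * τ + j) ω)
        - A (k * τ + j) ω (gradient f (x (k * τ + j) ω))‖ ^ 2 ∂μ
      ≤ (1 - δ / 2) * ∫ ω, ‖gradient f (x (k * τ + j) ω)‖ ^ 2 ∂μ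
        + 8 / δ * L ^ 2 * (j * ∑ i ∈ Finset.range j,
          ∫ ω, ‖x (k * τ + i + 1) ω - x (k * τ + i) ω‖ ^ 2 ∂μ) := by
  have h1 := h.residual_compare (c := δ / 4) (by positivity) (k * τ) (k * τ + j)
    (fun ω => h.held k j ω hj)
  have h2 := h.residual_start_le k
  have h3 := h.gradient_compare (c := δ / 4) (by positivity) (k * τ) (k * τ + j)
  simp only [norm_sub_rev (gradient f (x (k * τ) _))] at h3
  have h4 := h.gradient_dist_le (k * τ) j
  set R := ∫ ω, ‖gradient f (x (k * τ + j) ω) - gradient f (x (k * τ) ω)‖ ^ 2 ∂μ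
  set G := ∫ ω, ‖gradient f (x (k * τ + j) ω)‖ ^ 2 ∂μ
  set S := ∑ i ∈ Finset.range j, ∫ ω, ‖x (k * τ + i + 1) ω - x (k * τ + i) ω‖ ^ 2 ∂μ
  have hR : 0 ≤ R := integral_nonneg fun _ => by positivity
  have hG : 0 ≤ G := integral_nonneg fun _ => by positivity
  have hδ' : 0 ≤ 1 - δ := by linarith
  have h5 : (1 + δ / 4) * ((1 - δ) * ((1 + δ / 4) * G + (1 + 1 / (δ / 4)) * R))
      + (1 + 1 / (δ / 4)) * R ≤ (1 - δ / 2) * G + 8 / δ * R := by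
    -- Weight `δ/4` in both comparisons keeps half of the gain `δ`; the price is a drift coefficient
    -- of order `1/δ`.
    have c1 : (1 + δ / 4) * ((1 - δ) * (1 + δ / 4)) ≤ 1 - δ / 2 := by nlinarith [sq_nonneg δ]
    have c2 : (1 + δ / 4) * ((1 - δ) * (1 + 1 / (δ / 4))) + (1 + 1 / (δ / 4)) ≤ 8 / δ := by
      rw [le_div_iff₀ hδ]
      have : 1 / (δ / 4) * δ = 4 := by field_simp
      nlinarith [sq_nonneg δ]
    nlinarith [mul_le_mul_of_nonneg_right c1 hG, mul_le_mul_of_nonneg_right c2 hR]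
  calc _ ≤ _ := h1
    _ ≤ (1 + δ / 4) * ((1 - δ) * ((1 + δ / 4) * G + (1 + 1 / (δ / 4)) * R))
      + (1 + 1 / (δ / 4)) * R := by
        gcongr
        refine h2.trans ?_
        gcongr
    _ ≤ _ := h5
    _ ≤ (1 - δ / 2) * G + 8 / δ * (L ^ 2 * (j * S)) := by gcongr
    _ = _ := by ring

lemma gradient_dist_period_le {i j : ℕ} (hij : i ≤ j) (hj : j < τ) (k : ℕ) :
    ∫ ω, ‖gradient f (x (k * τ + j) ω) - gradient f (x (k * τ + i) ω)‖ ^ 2 ∂μ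
      ≤ L ^ 2 * (τ * ∑ i ∈ Finset.range τ,
        ∫ ω, ‖x (k * τ + i + 1) ω - x (k * τ + i) ω‖ ^ 2 ∂μ) := by
  obtain ⟨l, rfl⟩ := Nat.exists_eq_add_of_le hij
  have h1 := h.gradient_dist_le (k * τ + i) l
  rw [← add_assoc]
  have hpos : ∀ a, 0 ≤ ∫ ω, ‖x (a + 1) ω - x a ω‖ ^ 2 ∂μ :=
    fun a => integral_nonneg fun _ => by positivity
  refine h1.trans ?_
  have hsum : ∑ a ∈ Finset.range l, ∫ ω, ‖x (k * τ + i + a + 1) ω - x (k * τ + i + a) ω‖ ^ 2 ∂μ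
      ≤ ∑ a ∈ Finset.range τ, ∫ ω, ‖x (k * τ + a + 1) ω - x (k * τ + a) ω‖ ^ 2 ∂μ := by
    calc _ = ∑ a ∈ Finset.Ico i (i + l),
          ∫ ω, ‖x (k * τ + a + 1) ω - x (k * τ + a) ω‖ ^ 2 ∂μ := by
          rw [Finset.sum_Ico_eq_sum_range]
          simp only [add_tsub_cancel_left, add_assoc]
      _ ≤ _ := by
          refine Finset.sum_le_sum_of_subset_of_nonneg (fun a ha => ?_) fun a _ _ => hpos _
          rw [Finset.mem_Ico] at ha
          rw [Finset.mem_range]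
          omega
  have hl : (l : ℝ) ≤ τ := by
    exact_mod_cast (by omega : l ≤ τ)
  have : 0 ≤ ∑ a ∈ Finset.range l,
      ∫ ω, ‖x (k * τ + i + a + 1) ω - x (k * τ + i + a) ω‖ ^ 2 ∂μ :=
    Finset.sum_nonneg fun a _ => hpos _
  gcongr

lemma gradient_period_le (k i j : ℕ) (hi : i < τ) (hj : j < τ) :
    ∫ ω, ‖gradient f (x (k * τ + i) ω)‖ ^ 2 ∂μ
      ≤ 4 * ∫ ω, ‖gradient f (x (k * τ + j) ω)‖ ^ 2 ∂μ
        + 4 / 3 * L ^ 2 * τ * ∑ i ∈ Finset.range τ,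
          ∫ ω, ‖x (k * τ + i + 1) ω - x (k * τ + i) ω‖ ^ 2 ∂μ := by
  have h1 := h.gradient_compare (c := 3) (by norm_num) (k * τ + i) (k * τ + j)
  have h2 : ∫ ω, ‖gradient f (x (k * τ + i) ω) - gradient f (x (k * τ + j) ω)‖ ^ 2 ∂μ
      ≤ L ^ 2 * (τ * ∑ i ∈ Finset.range τ,
        ∫ ω, ‖x (k * τ + i + 1) ω - x (k * τ + i) ω‖ ^ 2 ∂μ) := by
    rcases le_total i j with hij | hij
    · simp only [norm_sub_rev (gradient f (x (k * τ + i) _))]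
      exact h.gradient_dist_period_le hij hj k
    · exact h.gradient_dist_period_le hij hi k
  linarith

theorem scalarRecursion (hL : 0 < L) (hβ : 0 < β) (hβ1 : β ≤ 1) (hδ : 0 < δ) (hδ1 : δ ≤ 1)
    (hη : 0 < η) (hηL : η ≤ 1 / (4 * L)) :
    ScalarRecursion β δ η L s2 τ (fun t => ∫ ω, ‖gradient f (x t ω)‖ ^ 2 ∂μ)
      (fun t => ∫ ω, ‖x (t + 1) ω - x t ω‖ ^ 2 ∂μ)
      (fun t => ∫ ω, ‖M (t + 1) ω - A t ω (gradient f (x t ω))‖ ^ 2 ∂μ)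
      (fun t => ∫ ω, ‖gradient f (x t ω) - A t ω (gradient f (x t ω))‖ ^ 2 ∂μ)
      (fun t => ∫ ω, f (x t ω) ∂μ) where
  g_nonneg t := integral_nonneg fun _ => by positivity
  d_nonneg t := integral_nonneg fun _ => by positivity
  u_nonneg t := integral_nonneg fun _ => by positivity
  v_le := h.residual_le
  descent := h.loss_succ_le hL hη hηL
  u_zero := h.error_zero_le hβ.le hβ1
  u_succ := h.error_succ_le hβ hβ1
  v_period := h.residual_period_le hδ hδ1
  g_period := h.gradient_period_le

lemma loss_gap_le (t : ℕ) :
    ∫ ω, f (x 0 ω) ∂μ - ∫ ω, f (x t ω) ∂μ ≤ f x₀ - ⨅ y, f y := by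
  have h1 : ∫ ω, f (x 0 ω) ∂μ = f x₀ := by simp [h.x_zero]
  have h2 : ⨅ y, f y ≤ ∫ ω, f (x t ω) ∂μ := by
    calc ⨅ y, f y = ∫ _, ⨅ y, f y ∂μ := by simp
      _ ≤ _ := integral_mono (integrable_const _) (h.integrable_loss t)
        fun _ => ciInf_le h.bddBelow _
  linarith

end

end ProjectedMomentum

end ProjectedMomentum

/-! ### Integration against independent random variables -/

section Independence

variable {Ω α β γ : Type*} [MeasurableSpace Ω] [MeasurableSpace α] [MeasurableSpace β]
  [MeasurableSpace γ] {μ : Measure Ω} [IsProbabilityMeasure μ]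

/-- The law of the triple is a product in either bracketing, by associativity of product measures.
-/
lemma indepFun_prodMk_right {X : Ω → α} {Y : Ω → β} {Z : Ω → γ} (hX : Measurable X)
    (hY : Measurable Y) (hZ : Measurable Z) (hXY : IndepFun X Y μ)
    (hXYZ : IndepFun (fun ω => (X ω, Y ω)) Z μ) : IndepFun X (fun ω => (Y ω, Z ω)) μ := by
  have := Measure.isProbabilityMeasure_map (μ := μ) hX.aemeasurable
  have := Measure.isProbabilityMeasure_map (μ := μ) hY.aemeasurable
  have := Measure.isProbabilityMeasure_map (μ := μ) hZ.aemeasurable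
  have hYZ : IndepFun Y Z μ := hXYZ.comp measurable_snd measurable_id
  rw [indepFun_iff_map_prod_eq_prod_map_map hX.aemeasurable (hY.prodMk hZ).aemeasurable,
    (indepFun_iff_map_prod_eq_prod_map_map hY.aemeasurable hZ.aemeasurable).1 hYZ,
    ← Measure.prodAssoc_prod,
    ← (indepFun_iff_map_prod_eq_prod_map_map hX.aemeasurable hY.aemeasurable).1 hXY,
    ← (indepFun_iff_map_prod_eq_prod_map_map (hX.prodMk hY).aemeasurable hZ.aemeasurable).1 hXYZ,
    Measure.map_map (MeasurableEquiv.measurable _) ((hX.prodMk hY).prodMk hZ)]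
  rfl

omit [IsProbabilityMeasure μ] in
lemma indepFun_of_measurable_comap {X : Ω → α} {H : Ω → β} {W : Ω → γ} (hXH : IndepFun X H μ)
    (hW : Measurable[MeasurableSpace.comap H inferInstance] W) : IndepFun X W μ :=
  indep_of_indep_of_le_right hXH hW.comap_le

lemma integral_comp_of_indepFun {X : Ω → α} {Y : Ω → β} (hX : Measurable X) (hY : Measurable Y)
    (hXY : IndepFun X Y μ) {h : α × β → ℝ} (hm : Measurable h)
    (hint : Integrable (fun ω => h (X ω, Y ω)) μ) :
    ∫ ω, h (X ω, Y ω) ∂μ = ∫ ω, ∫ y, h (X ω, y) ∂(μ.map Y) ∂μ := by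
  have := Measure.isProbabilityMeasure_map (μ := μ) hX.aemeasurable
  have := Measure.isProbabilityMeasure_map (μ := μ) hY.aemeasurable
  have e := (indepFun_iff_map_prod_eq_prod_map_map hX.aemeasurable hY.aemeasurable).1 hXY
  have hint' : Integrable h ((μ.map X).prod (μ.map Y)) := by
    rw [← e, integrable_map_measure hm.aestronglyMeasurable (hX.prodMk hY).aemeasurable]
    exact hint
  rw [← integral_map (φ := fun ω => (X ω, Y ω)) (hX.prodMk hY).aemeasurable
    hm.aestronglyMeasurable, e, integral_prod _ hint', integral_map hX.aemeasurable]
  exact hint'.aestronglyMeasurable.integral_prod_right'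

/-- Integrability is not known beforehand, so the bound is first obtained for the Lebesgue integral
in `[0, ∞]` by Tonelli; Fubini then gives the real inequality. -/
lemma integrable_comp_of_indepFun {X : Ω → α} {Y : Ω → β} (hX : Measurable X)
    (hY : Measurable Y) (hXY : IndepFun X Y μ) {h : α × β → ℝ} (hm : Measurable h)
    (h0 : ∀ p, 0 ≤ h p) {c : ℝ} (hi : ∀ x, Integrable (fun y => h (x, y)) (μ.map Y))
    (hc : ∀ x, ∫ y, h (x, y) ∂(μ.map Y) ≤ c) :
    Integrable (fun ω => h (X ω, Y ω)) μ ∧ ∫ ω, h (X ω, Y ω) ∂μ ≤ c := by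
  have := Measure.isProbabilityMeasure_map (μ := μ) hX.aemeasurable
  have := Measure.isProbabilityMeasure_map (μ := μ) hY.aemeasurable
  have e := (indepFun_iff_map_prod_eq_prod_map_map hX.aemeasurable hY.aemeasurable).1 hXY
  have hl : ∫⁻ ω, ENNReal.ofReal (h (X ω, Y ω)) ∂μ ≤ ENNReal.ofReal c := by
    rw [← lintegral_map (f := fun p => ENNReal.ofReal (h p)) (g := fun ω => (X ω, Y ω))
      hm.ennreal_ofReal (hX.prodMk hY), e, lintegral_prod _ hm.ennreal_ofReal.aemeasurable]
    calc _ ≤ ∫⁻ _, ENNReal.ofReal c ∂(μ.map X) := lintegral_mono fun x => by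
          rw [← ofReal_integral_eq_lintegral_ofReal (hi x)
            (Filter.Eventually.of_forall fun y => h0 _)]
          exact ENNReal.ofReal_le_ofReal (hc x)
      _ = _ := by simp
  have hint : Integrable (fun ω => h (X ω, Y ω)) μ := by
    refine ⟨(hm.comp (hX.prodMk hY)).aestronglyMeasurable, ?_⟩
    rw [hasFiniteIntegral_iff_ofReal (Filter.Eventually.of_forall fun ω => h0 _)]
    exact hl.trans_lt ENNReal.ofReal_lt_top
  refine ⟨hint, ?_⟩
  rw [integral_comp_of_indepFun hX hY hXY hm hint]
  calc _ ≤ ∫ _, c ∂μ := integral_mono_of_nonneg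
        (Filter.Eventually.of_forall fun ω => integral_nonneg fun y => h0 _)
        (integrable_const _) (Filter.Eventually.of_forall fun ω => hc _)
    _ = _ := by simp

end Independence

/-! ### Measurability of the run -/

section Measurability

instance instSecondCountableTopologyMatrix {a b : Type*} [Countable a] [Countable b] :
    SecondCountableTopology (Matrix a b ℝ) :=
  inferInstanceAs (SecondCountableTopology (a → b → ℝ))

variable {Ω : Type*} [MeasurableSpace Ω]

lemma measurable_matrix_mul {a b c : ℕ} {A : Ω → Matrix (Fin a) (Fin b) ℝ}
    {B : Ω → Matrix (Fin b) (Fin c) ℝ} (hA : Measurable A) (hB : Measurable B) :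
    Measurable fun ω => A ω * B ω :=
  (by fun_prop : Continuous fun p : Matrix (Fin a) (Fin b) ℝ × Matrix (Fin b) (Fin c) ℝ =>
    p.1 * p.2).measurable.comp (hA.prodMk hB)

lemma measurable_matrix_smul {a b : ℕ} (c : ℝ) {A : Ω → Matrix (Fin a) (Fin b) ℝ}
    (hA : Measurable A) : Measurable fun ω => c • A ω :=
  (by fun_prop : Continuous fun p : Matrix (Fin a) (Fin b) ℝ => c • p).measurable.comp hA

lemma measurable_matrix_transpose {a b : ℕ} {A : Ω → Matrix (Fin a) (Fin b) ℝ}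
    (hA : Measurable A) : Measurable fun ω => (A ω).transpose :=
  (by fun_prop : Continuous fun p : Matrix (Fin a) (Fin b) ℝ => p.transpose).measurable.comp hA

variable {N : ℕ} {m n r : Fin N → ℕ}

lemma continuous_block (ℓ : Fin N) : Continuous fun v : Params m n => block v ℓ :=
  continuous_matrix fun i j => by
    change Continuous fun v : Params m n => v ⟨ℓ, i, j⟩
    fun_prop

lemma continuous_frobSq {a b : ℕ} :
    Continuous fun A : Matrix (Fin a) (Fin b) ℝ => frobSq A := by
  unfold frobSq
  fun_prop

lemma measurable_block {v : Ω → Params m n} (hv : Measurable v) (ℓ : Fin N) :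
    Measurable fun ω => block (v ω) ℓ :=
  (continuous_block ℓ).measurable.comp hv

lemma measurable_of_block {v : Ω → Params m n} (hv : ∀ ℓ, Measurable fun ω => block (v ω) ℓ) :
    Measurable v := by
  refine (WithLp.measurable_toLp 2 _).comp (g := WithLp.toLp 2)
    (f := fun ω (p : Σ ℓ : Fin N, Fin (m ℓ) × Fin (n ℓ)) => block (v ω) p.1 p.2.1 p.2.2) (measurable_pi_iff.2 fun p => ?_)
  exact (by fun_prop : Continuous fun A : Matrix (Fin (m p.1)) (Fin (n p.1)) ℝ =>
    A p.2.1 p.2.2).measurable.comp (hv p.1)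

lemma measurable_held {β : Fin N → Type*}
    [∀ ℓ, MeasurableSpace (β ℓ)] (τ : ℕ) {S : ℕ → ∀ ℓ, Ω → β ℓ} {t : ℕ}
    (hS : ∀ s ≤ t, ∀ ℓ, Measurable (S s ℓ)) (ℓ : Fin N) :
    Measurable fun ω => held τ (fun s ℓ => S s ℓ ω) t ℓ := by
  induction t with
  | zero => exact hS 0 le_rfl ℓ
  | succ t ih =>
    by_cases h : τ ∣ t + 1
    · simp only [held, h, if_true]
      exact hS (t + 1) le_rfl ℓ
    · simp only [held, h, if_false]
      exact ih fun s hs => hS s (by omega)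

variable {P P' : Ω → ∀ ℓ, Matrix (Fin (m ℓ)) (Fin (r ℓ)) ℝ}
  {Q Q' : Ω → ∀ ℓ, Matrix (Fin (n ℓ)) (Fin (r ℓ)) ℝ}

/-- All components of a random state are measurable. -/
structure MeasurableState (s : Ω → State m n r) : Prop where
  x : Measurable fun ω => (s ω).x
  left : ∀ ℓ, Measurable fun ω => (s ω).left ℓ
  right : ∀ ℓ, Measurable fun ω => (s ω).right ℓ

lemma measurable_blockProj (hP : ∀ ℓ, Measurable fun ω => P ω ℓ)
    (hQ : ∀ ℓ, Measurable fun ω => Q ω ℓ) {v : Ω → Params m n} (hv : Measurable v) :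
    Measurable fun ω => blockProj (P ω) (Q ω) (v ω) := by
  refine measurable_of_block fun ℓ => ?_
  by_cases h : m ℓ ≤ n ℓ
  · simp only [block_blockProj, h, if_true]
    exact measurable_matrix_mul (measurable_matrix_mul (hP ℓ) (measurable_matrix_transpose (hP ℓ)))
      (measurable_block hv ℓ)
  · simp only [block_blockProj, h, if_false]
    exact measurable_matrix_mul (measurable_block hv ℓ)
      (measurable_matrix_mul (hQ ℓ) (measurable_matrix_transpose (hQ ℓ)))

lemma measurable_fullMomentum (hP : ∀ ℓ, Measurable fun ω => P ω ℓ)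
    (hQ : ∀ ℓ, Measurable fun ω => Q ω ℓ) {s : Ω → State m n r}
    (hl : ∀ ℓ, Measurable fun ω => (s ω).left ℓ) (hr : ∀ ℓ, Measurable fun ω => (s ω).right ℓ) :
    Measurable fun ω => fullMomentum (P ω) (Q ω) (s ω) := by
  refine measurable_of_block fun ℓ => ?_
  by_cases h : m ℓ ≤ n ℓ
  · simp only [block_fullMomentum, h, if_true]
    exact measurable_matrix_mul (hP ℓ) (hl ℓ)
  · simp only [block_fullMomentum, h, if_false]
    exact measurable_matrix_mul (hr ℓ) (measurable_matrix_transpose (hQ ℓ))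

lemma measurableState_step (β η : ℝ) (τ t : ℕ) (hP : ∀ ℓ, Measurable fun ω => P ω ℓ)
    (hP' : ∀ ℓ, Measurable fun ω => P' ω ℓ) (hQ : ∀ ℓ, Measurable fun ω => Q ω ℓ)
    (hQ' : ∀ ℓ, Measurable fun ω => Q' ω ℓ) {G : Ω → Params m n} (hG : Measurable G)
    {s : Ω → State m n r} (hs : MeasurableState s) :
    MeasurableState fun ω => step β η τ t (P ω) (P' ω) (Q ω) (Q' ω) (G ω) (s ω) := by
  have hl : ∀ ℓ, Measurable fun ω =>
      (step β η τ t (P ω) (P' ω) (Q ω) (Q' ω) (G ω) (s ω)).left ℓ := fun ℓ => by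
    refine Measurable.add (measurable_matrix_smul _ ?_) (measurable_matrix_smul _
      (measurable_matrix_mul (measurable_matrix_transpose (hP ℓ)) (measurable_block hG ℓ)))
    by_cases h : τ ∣ t
    · simp only [h, if_true]
      exact measurable_matrix_mul (measurable_matrix_mul (measurable_matrix_transpose (hP ℓ))
        (hP' ℓ)) (hs.left ℓ)
    · simp only [h, if_false]
      exact hs.left ℓ
  have hr : ∀ ℓ, Measurable fun ω =>
      (step β η τ t (P ω) (P' ω) (Q ω) (Q' ω) (G ω) (s ω)).right ℓ := fun ℓ => by
    refine Measurable.add (measurable_matrix_smul _ ?_) (measurable_matrix_smul _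
      (measurable_matrix_mul (measurable_block hG ℓ) (hQ ℓ)))
    by_cases h : τ ∣ t
    · simp only [h, if_true]
      exact measurable_matrix_mul (measurable_matrix_mul (hs.right ℓ)
        (measurable_matrix_transpose (hQ' ℓ))) (hQ ℓ)
    · simp only [h, if_false]
      exact hs.right ℓ
  refine ⟨?_, hl, hr⟩
  simp only [step_x]
  exact hs.x.sub ((measurable_fullMomentum hP hQ hl hr).const_smul η)

/-- Only inputs at times before `t` are assumed measurable, and the σ-algebra on `Ω` is arbitrary.
It can therefore be taken as the σ-algebra generated by a history, which yields independence
statements. -/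
lemma measurableState_run {Ξ : Type*} [MeasurableSpace Ξ] {F : Params m n → Ξ → ℝ}
    (hF : Measurable fun p : Params m n × Ξ => stochGrad F p.1 p.2) (β η : ℝ) (τ : ℕ)
    (x₀ : Params m n) {ξ : ℕ → Ω → Ξ}
    {P : ℕ → ∀ ℓ, Ω → Matrix (Fin (m ℓ)) (Fin (r ℓ)) ℝ}
    {Q : ℕ → ∀ ℓ, Ω → Matrix (Fin (n ℓ)) (Fin (r ℓ)) ℝ} {t : ℕ}
    (hξ : ∀ s < t, Measurable (ξ s)) (hP : ∀ s < t, ∀ ℓ, Measurable (P s ℓ))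
    (hQ : ∀ s < t, ∀ ℓ, Measurable (Q s ℓ)) :
    MeasurableState fun ω => run F β η τ x₀ (fun s => ξ s ω) (fun s ℓ => P s ℓ ω)
      (fun s ℓ => Q s ℓ ω) t := by
  induction t with
  | zero => exact ⟨measurable_const, fun ℓ => measurable_const, fun ℓ => measurable_const⟩
  | succ t ih =>
    have hs := ih (fun s hs => hξ s (by omega)) (fun s hs => hP s (by omega))
      (fun s hs => hQ s (by omega))
    exact measurableState_step β η τ t
      (measurable_held τ fun s hs => hP s (by omega))
      (measurable_held τ fun s hs => hP s (by omega))
      (measurable_held τ fun s hs => hQ s (by omega))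
      (measurable_held τ fun s hs => hQ s (by omega))
      (hF.comp (hs.x.prodMk (hξ t (by omega)))) hs

end Measurability

/-! ### Sampled matrices held over a period -/

lemma held_mul {α : Type*} (τ : ℕ) (S : ℕ → α) (k : ℕ) : held τ S (k * τ) = S (k * τ) := by
  rcases h : k * τ with _ | t
  · rfl
  · rw [held, if_pos (h ▸ Dvd.intro_left k rfl)]

lemma held_mul_add {α : Type*} {τ : ℕ} (S : ℕ → α) (k : ℕ) {j : ℕ} (hj : j < τ) :
    held τ S (k * τ + j) = held τ S (k * τ) := by
  induction j with
  | zero => rfl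
  | succ j ih =>
    rw [← ih (by omega), ← add_assoc, held, if_neg]
    rw [add_assoc, Nat.dvd_add_right (Dvd.intro_left k rfl)]
    intro hd
    have := Nat.le_of_dvd (by omega) hd
    omega

lemma held_of_not_dvd {α : Type*} {τ : ℕ} (S : ℕ → α) {t : ℕ} (ht : ¬ τ ∣ t) :
    held τ S t = held τ S (t - 1) := by
  rcases t with _ | t
  -- Time `0` counts as a refresh, so the truncated `0 - 1` never matters.
  · exact absurd (dvd_zero τ) ht
  · rw [held, if_neg ht]
    rfl

/-- Lets the matrix in use inherit orthonormality from the drawn ones. -/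
lemma held_mem {α : Type*} (τ : ℕ) (S : ℕ → α) (t : ℕ) : ∃ s ≤ t, held τ S t = S s := by
  induction t with
  | zero => exact ⟨0, le_rfl, rfl⟩
  | succ t ih =>
    by_cases h : τ ∣ t + 1
    · exact ⟨t + 1, le_rfl, by rw [held, if_pos h]⟩
    · obtain ⟨s, hs, e⟩ := ih
      exact ⟨s, by omega, by rw [held, if_neg h, e]⟩

/-! ### GoLore as a projected momentum process -/

section Instantiation

variable {N : ℕ} {m n r : Fin N → ℕ} {Ω Ξ : Type*}

/-- The blockwise projection in use at time `t`. -/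
noncomputable def projAt (τ : ℕ) (P : ℕ → ∀ ℓ, Ω → Matrix (Fin (m ℓ)) (Fin (r ℓ)) ℝ)
    (Q : ℕ → ∀ ℓ, Ω → Matrix (Fin (n ℓ)) (Fin (r ℓ)) ℝ) (t : ℕ) (ω : Ω) :
    Params m n →ₗ[ℝ] Params m n :=
  blockProj (held τ (fun s ℓ => P s ℓ ω) t) (held τ (fun s ℓ => Q s ℓ ω) t)

/-- The momentum before step `t`, in the parameter space. -/
noncomputable def momentumAt (F : Params m n → Ξ → ℝ) (β η : ℝ) (τ : ℕ) (x₀ : Params m n)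
    (ξ : ℕ → Ω → Ξ) (P : ℕ → ∀ ℓ, Ω → Matrix (Fin (m ℓ)) (Fin (r ℓ)) ℝ)
    (Q : ℕ → ∀ ℓ, Ω → Matrix (Fin (n ℓ)) (Fin (r ℓ)) ℝ) (t : ℕ) (ω : Ω) : Params m n :=
  fullMomentum (held τ (fun s ℓ => P s ℓ ω) (t - 1)) (held τ (fun s ℓ => Q s ℓ ω) (t - 1))
    (run F β η τ x₀ (fun s => ξ s ω) (fun s ℓ => P s ℓ ω) (fun s ℓ => Q s ℓ ω) t)

/-- The error of the stochastic gradient. -/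
noncomputable def gradNoise [MeasurableSpace Ξ] (F : Params m n → Ξ → ℝ) (D : Measure Ξ)
    (x : Params m n) (y : Ξ) : Params m n :=
  stochGrad F x y - gradient (objective F D) x

section Recursion

variable (F : Params m n → Ξ → ℝ) (β η : ℝ) {τ : ℕ} (x₀ : Params m n) (ξ : ℕ → Ω → Ξ)
  {P : ℕ → ∀ ℓ, Ω → Matrix (Fin (m ℓ)) (Fin (r ℓ)) ℝ}
  {Q : ℕ → ∀ ℓ, Ω → Matrix (Fin (n ℓ)) (Fin (r ℓ)) ℝ}

lemma momentumAt_zero (ω : Ω) : momentumAt F β η τ x₀ ξ P Q 0 ω = 0 := by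
  refine ext_block fun ℓ => ?_
  simp [momentumAt, block_fullMomentum, run]

lemma iterate_succ (t : ℕ) (ω : Ω) : iterate F β η τ x₀ ξ P Q (t + 1) ω
    = iterate F β η τ x₀ ξ P Q t ω - η • momentumAt F β η τ x₀ ξ P Q (t + 1) ω :=
  step_x β η τ t _ _

lemma momentumAt_succ {ω : Ω}
    (hω : ∀ t, Orthonormals (fun ℓ => P t ℓ ω) (fun ℓ => Q t ℓ ω)) (t : ℕ) :
    momentumAt F β η τ x₀ ξ P Q (t + 1) ω = projAt τ P Q t ω
      ((1 - β) • momentumAt F β η τ x₀ ξ P Q t ω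
        + β • stochGrad F (iterate F β η τ x₀ ξ P Q t ω) (ξ t ω)) := by
  by_cases ht : τ ∣ t
  · exact fullMomentum_step_of_dvd β η ht _ _
  · have hheld : Orthonormals (held τ (fun s ℓ => P s ℓ ω) t) (held τ (fun s ℓ => Q s ℓ ω) t) := by
      intro ℓ
      obtain ⟨s, -, hs⟩ := held_mem τ (fun s ℓ => P s ℓ ω) t
      obtain ⟨s', -, hs'⟩ := held_mem τ (fun s ℓ => Q s ℓ ω) t
      rw [hs, hs']
      exact ⟨(hω s ℓ).1, (hω s' ℓ).2⟩
    have := hheld.fullMomentum_step_of_not_dvd (P' := held τ (fun s ℓ => P s ℓ ω) (t - 1))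
      (Q' := held τ (fun s ℓ => Q s ℓ ω) (t - 1)) β η ht
      (stochGrad F (iterate F β η τ x₀ ξ P Q t ω) (ξ t ω))
      (run F β η τ x₀ (fun s => ξ s ω) (fun s ℓ => P s ℓ ω) (fun s ℓ => Q s ℓ ω) t)
    -- Without a refresh the matrices of time `t - 1` are those of time `t`, so both momenta are
    -- lifted by the same matrices.
    rw [momentumAt, momentumAt, projAt, ← held_of_not_dvd _ ht, ← held_of_not_dvd _ ht]
    exact this

lemma projAt_isSymmetricProjection {ω : Ω}
    (hω : ∀ t, Orthonormals (fun ℓ => P t ℓ ω) (fun ℓ => Q t ℓ ω)) (t : ℕ) :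
    (projAt τ P Q t ω).IsSymmetricProjection := by
  refine Orthonormals.isSymmetricProjection fun ℓ => ?_
  obtain ⟨s, -, hs⟩ := held_mem τ (fun s ℓ => P s ℓ ω) t
  obtain ⟨s', -, hs'⟩ := held_mem τ (fun s ℓ => Q s ℓ ω) t
  rw [hs, hs']
  exact ⟨(hω s ℓ).1, (hω s' ℓ).2⟩

lemma projAt_held (k j : ℕ) (ω : Ω) (hj : j < τ) :
    projAt τ P Q (k * τ + j) ω = projAt τ P Q (k * τ) ω := by
  rw [projAt, projAt, held_mul_add _ k hj, held_mul_add _ k hj]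

end Recursion

/-! ### Histories of the random inputs -/

section History

variable [MeasurableSpace Ξ] {ξ : ℕ → Ω → Ξ}
  {P : ℕ → ∀ ℓ, Ω → Matrix (Fin (m ℓ)) (Fin (r ℓ)) ℝ}
  {Q : ℕ → ∀ ℓ, Ω → Matrix (Fin (n ℓ)) (Fin (r ℓ)) ℝ}

/-- The data points before time `t` and all projections. -/
def dataHistory (ξ : ℕ → Ω → Ξ) (P : ℕ → ∀ ℓ, Ω → Matrix (Fin (m ℓ)) (Fin (r ℓ)) ℝ)
    (Q : ℕ → ∀ ℓ, Ω → Matrix (Fin (n ℓ)) (Fin (r ℓ)) ℝ) (t : ℕ) (ω : Ω) :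
    (Finset.range t → Ξ) × (∀ i : ℕ × Fin N, Matrix (Fin (m i.2)) (Fin (r i.2)) ℝ ×
      Matrix (Fin (n i.2)) (Fin (r i.2)) ℝ) :=
  (fun s => ξ s ω, fun i => (P i.1 i.2 ω, Q i.1 i.2 ω))

/-- The projections before time `t` and all data points. -/
def projHistory (ξ : ℕ → Ω → Ξ) (P : ℕ → ∀ ℓ, Ω → Matrix (Fin (m ℓ)) (Fin (r ℓ)) ℝ)
    (Q : ℕ → ∀ ℓ, Ω → Matrix (Fin (n ℓ)) (Fin (r ℓ)) ℝ) (t : ℕ) (ω : Ω) :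
    (∀ i : (Finset.range t ×ˢ (Finset.univ : Finset (Fin N)) : Finset (ℕ × Fin N)),
      Matrix (Fin (m i.1.2)) (Fin (r i.1.2)) ℝ × Matrix (Fin (n i.1.2)) (Fin (r i.1.2)) ℝ)
      × (ℕ → Ξ) :=
  (fun i => (P i.1.1 i.1.2 ω, Q i.1.1 i.1.2 ω), fun s => ξ s ω)

lemma measurable_comap_dataHistory (t : ℕ) {s : ℕ} (hs : s < t) :
    Measurable[MeasurableSpace.comap (dataHistory ξ P Q t) inferInstance] (ξ s) :=
  (measurable_pi_apply (⟨s, Finset.mem_range.2 hs⟩ : Finset.range t)).comp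
    (measurable_fst.comp (comap_measurable (dataHistory ξ P Q t)))

lemma measurable_comap_dataHistory_pair (t s : ℕ) (ℓ : Fin N) :
    Measurable[MeasurableSpace.comap (dataHistory ξ P Q t) inferInstance]
      fun ω => (P s ℓ ω, Q s ℓ ω) :=
  (measurable_pi_apply (s, ℓ)).comp
    (measurable_snd.comp (comap_measurable (dataHistory ξ P Q t)))

lemma measurable_comap_projHistory (t s : ℕ) :
    Measurable[MeasurableSpace.comap (projHistory ξ P Q t) inferInstance] (ξ s) :=
  (measurable_pi_apply s).comp (measurable_snd.comp (comap_measurable (projHistory ξ P Q t)))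

lemma measurable_comap_projHistory_pair (t : ℕ) {s : ℕ} (hs : s < t) (ℓ : Fin N) :
    Measurable[MeasurableSpace.comap (projHistory ξ P Q t) inferInstance]
      fun ω => (P s ℓ ω, Q s ℓ ω) :=
  (measurable_pi_apply (⟨(s, ℓ), by simp [hs]⟩ :
    (Finset.range t ×ˢ (Finset.univ : Finset (Fin N)) : Finset (ℕ × Fin N)))).comp
    (measurable_fst.comp (comap_measurable (projHistory ξ P Q t)))

end History

variable [MeasurableSpace Ω] [MeasurableSpace Ξ]

section MeasurableProcess

variable {F : Params m n → Ξ → ℝ} {ξ : ℕ → Ω → Ξ}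
  {P : ℕ → ∀ ℓ, Ω → Matrix (Fin (m ℓ)) (Fin (r ℓ)) ℝ}
  {Q : ℕ → ∀ ℓ, Ω → Matrix (Fin (n ℓ)) (Fin (r ℓ)) ℝ}

lemma measurable_iterate (hF : Measurable fun p : Params m n × Ξ => stochGrad F p.1 p.2)
    (β η : ℝ) (τ : ℕ) (x₀ : Params m n) {t : ℕ} (hξ : ∀ s < t, Measurable (ξ s))
    (hP : ∀ s < t, ∀ ℓ, Measurable (P s ℓ)) (hQ : ∀ s < t, ∀ ℓ, Measurable (Q s ℓ)) :
    Measurable (iterate F β η τ x₀ ξ P Q t) :=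
  (measurableState_run hF β η τ x₀ hξ hP hQ).x

lemma measurable_momentumAt (hF : Measurable fun p : Params m n × Ξ => stochGrad F p.1 p.2)
    (β η : ℝ) (τ : ℕ) (x₀ : Params m n) {t : ℕ} (hξ : ∀ s < t, Measurable (ξ s))
    (hP : ∀ s, ∀ ℓ, Measurable (P s ℓ)) (hQ : ∀ s, ∀ ℓ, Measurable (Q s ℓ)) :
    Measurable (momentumAt F β η τ x₀ ξ P Q t) :=
  have h := measurableState_run hF β η τ x₀ hξ (fun s _ => hP s) (fun s _ => hQ s)
  measurable_fullMomentum (measurable_held τ fun s _ => hP s) (measurable_held τ fun s _ => hQ s)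
    h.left h.right

lemma measurable_projAt (τ : ℕ) (hP : ∀ s, ∀ ℓ, Measurable (P s ℓ))
    (hQ : ∀ s, ∀ ℓ, Measurable (Q s ℓ)) (t : ℕ) {w : Ω → Params m n} (hw : Measurable w) :
    Measurable fun ω => projAt τ P Q t ω (w ω) :=
  measurable_blockProj (measurable_held τ fun s _ => hP s) (measurable_held τ fun s _ => hQ s) hw

end MeasurableProcess

/-! ### Independence of the run from fresh draws -/

section Sampling

variable {μ : Measure Ω} {D : Measure Ξ} {ξ : ℕ → Ω → Ξ}
  {P : ℕ → ∀ ℓ, Ω → Matrix (Fin (m ℓ)) (Fin (r ℓ)) ℝ}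
  {Q : ℕ → ∀ ℓ, Ω → Matrix (Fin (n ℓ)) (Fin (r ℓ)) ℝ}

namespace Sampling

variable (hS : Sampling μ D ξ P Q)
include hS

lemma measurable_pair (i : ℕ × Fin N) : Measurable fun ω => (P i.1 i.2 ω, Q i.1 i.2 ω) :=
  (hS.measurable_left i.1 i.2).prodMk (hS.measurable_right i.1 i.2)

variable [IsProbabilityMeasure μ]

/-- The new data point is independent of the earlier ones, and all data are independent of all
projections; including every projection in the history is harmless and avoids tracking which ones
are in use. -/
lemma indepFun_dataHistory (t : ℕ) : IndepFun (ξ t) (dataHistory ξ P Q t) μ := by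
  refine indepFun_prodMk_right (hS.measurable_data t)
    (measurable_pi_iff.2 fun s => hS.measurable_data s)
    (measurable_pi_iff.2 fun i => hS.measurable_pair i) ?_ ?_
  · have := hS.indep_data.indepFun_finset {t} (Finset.range t) (by simp) hS.measurable_data
    exact this.comp (measurable_pi_apply ⟨t, Finset.mem_singleton_self t⟩) measurable_id
  · exact hS.indep_data_proj.comp (φ := fun z : ℕ → Ξ => (z t, fun s : Finset.range t => z s))
      (by fun_prop) measurable_id

lemma indepFun_projHistory (t : ℕ) (ℓ : Fin N) :
    IndepFun (fun ω => (P t ℓ ω, Q t ℓ ω)) (projHistory ξ P Q t) μ := by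
  refine indepFun_prodMk_right (hS.measurable_pair (t, ℓ))
    (measurable_pi_iff.2 fun i => hS.measurable_pair i.1)
    (measurable_pi_iff.2 fun s => hS.measurable_data s) ?_ ?_
  · have := hS.indep_proj.indepFun_finset {(t, ℓ)} (Finset.range t ×ˢ Finset.univ) (by simp)
      hS.measurable_pair
    exact this.comp (measurable_pi_apply ⟨(t, ℓ), Finset.mem_singleton_self _⟩) measurable_id
  · exact hS.indep_data_proj.symm.comp
      (φ := fun z : ∀ i : ℕ × Fin N, Matrix (Fin (m i.2)) (Fin (r i.2)) ℝ ×
        Matrix (Fin (n i.2)) (Fin (r i.2)) ℝ => (z (t, ℓ),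
          fun i : (Finset.range t ×ˢ (Finset.univ : Finset (Fin N)) : Finset (ℕ × Fin N)) => z i.1))
      (by fun_prop) measurable_id

omit [IsProbabilityMeasure μ] in
lemma ae_orthonormals (hr : ∀ ℓ, r ℓ ≤ m ℓ ∧ r ℓ ≤ n ℓ) :
    ∀ᵐ ω ∂μ, ∀ t, Orthonormals (fun ℓ => P t ℓ ω) (fun ℓ => Q t ℓ ω) := by
  simp only [Orthonormals, ae_all_iff]
  intro t ℓ
  have h1 : ∀ᵐ ω ∂μ, (P t ℓ ω).transpose * P t ℓ ω = 1 := by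
    refine ae_of_ae_map (p := fun A => A.transpose * A = 1)
      (hS.measurable_left t ℓ).aemeasurable ?_
    rw [hS.law_left]
    exact ae_stiefelUniform (hr ℓ).1
  have h2 : ∀ᵐ ω ∂μ, (Q t ℓ ω).transpose * Q t ℓ ω = 1 := by
    refine ae_of_ae_map (p := fun A => A.transpose * A = 1)
      (hS.measurable_right t ℓ).aemeasurable ?_
    rw [hS.law_right]
    exact ae_stiefelUniform (hr ℓ).2
  exact h1.and h2

variable {F : Params m n → Ξ → ℝ}

/-- The current iterate, projection and momentum are independent of the next data point. -/
lemma indepFun_state (hF : Measurable fun p : Params m n × Ξ => stochGrad F p.1 p.2)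
    (β η : ℝ) (τ : ℕ) (x₀ : Params m n) {g : Params m n → Params m n} (hg : Measurable g)
    (t : ℕ) :
    IndepFun (fun ω => (projAt τ P Q t ω (momentumAt F β η τ x₀ ξ P Q t ω
      - g (iterate F β η τ x₀ ξ P Q t ω)), iterate F β η τ x₀ ξ P Q t ω)) (ξ t) μ := by
  refine (indepFun_of_measurable_comap (hS.indepFun_dataHistory t) ?_).symm
  -- Replacing the σ-algebra on `Ω` by that of the history, the general measurability lemmas say
  -- that the state is a function of the history.
  let _ : MeasurableSpace Ω := MeasurableSpace.comap (dataHistory ξ P Q t) inferInstance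
  have hP : ∀ s ℓ, Measurable (P s ℓ) := fun s ℓ =>
    measurable_fst.comp (measurable_comap_dataHistory_pair t s ℓ)
  have hQ : ∀ s ℓ, Measurable (Q s ℓ) := fun s ℓ =>
    measurable_snd.comp (measurable_comap_dataHistory_pair t s ℓ)
  have hξ : ∀ s < t, Measurable (ξ s) := fun s hs => measurable_comap_dataHistory t hs
  have hx := measurable_iterate hF β η τ x₀ hξ (fun s _ => hP s) (fun s _ => hQ s)
  exact (measurable_projAt τ hP hQ t ((measurable_momentumAt hF β η τ x₀ hξ hP hQ).sub
    (hg.comp hx))).prodMk hx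

/-- The iterate at time `t` is independent of the projections drawn at time `t`. -/
lemma indepFun_iterate_pair (hF : Measurable fun p : Params m n × Ξ => stochGrad F p.1 p.2)
    (β η : ℝ) (τ : ℕ) (x₀ : Params m n) (t : ℕ) (ℓ : Fin N) :
    IndepFun (iterate F β η τ x₀ ξ P Q t) (fun ω => (P t ℓ ω, Q t ℓ ω)) μ := by
  refine (indepFun_of_measurable_comap (hS.indepFun_projHistory t ℓ) ?_).symm
  let _ : MeasurableSpace Ω := MeasurableSpace.comap (projHistory ξ P Q t) inferInstance
  exact measurable_iterate hF β η τ x₀ (fun s _ => measurable_comap_projHistory t s)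
    (fun s hs ℓ => measurable_fst.comp (measurable_comap_projHistory_pair t hs ℓ))
    (fun s hs ℓ => measurable_snd.comp (measurable_comap_projHistory_pair t hs ℓ))

end Sampling

end Sampling

end Instantiation

/-! ### Bounds on the smallest rank ratio -/

section MinDelta

variable {N : ℕ} {m n r : Fin N → ℕ}

lemma minDelta_le (ℓ : Fin N) : minDelta m n r ≤ (r ℓ : ℝ) / (min (m ℓ) (n ℓ) : ℕ) :=
  ciInf_le (Set.finite_range _).bddBelow ℓ

/-- The infimum over finitely many layers is attained; `0 < N` excludes the empty family. -/
lemma minDelta_pos (hN : 0 < N) (hr : ∀ ℓ, 1 ≤ r ℓ ∧ r ℓ ≤ m ℓ ∧ r ℓ ≤ n ℓ) :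
    0 < minDelta m n r := by
  have : Nonempty (Fin N) := ⟨⟨0, hN⟩⟩
  obtain ⟨ℓ, hℓ⟩ := exists_eq_ciInf_of_finite
    (f := fun ℓ : Fin N => (r ℓ : ℝ) / (min (m ℓ) (n ℓ) : ℕ))
  rw [minDelta, ← hℓ]
  obtain ⟨h1, h2, h3⟩ := hr ℓ
  have h4 : 0 < min (m ℓ) (n ℓ) := by omega
  have h5 : 0 < r ℓ := h1
  positivity

lemma minDelta_le_one (hN : 0 < N) (hr : ∀ ℓ, 1 ≤ r ℓ ∧ r ℓ ≤ m ℓ ∧ r ℓ ≤ n ℓ) :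
    minDelta m n r ≤ 1 := by
  refine (minDelta_le ⟨0, hN⟩).trans (div_le_one_of_le₀ ?_ (Nat.cast_nonneg _))
  obtain ⟨-, h2, h3⟩ := hr ⟨0, hN⟩
  exact_mod_cast le_min h2 h3

end MinDelta

/-! ### Moments of the gradient noise -/

section Noise

variable {N : ℕ} {m n : Fin N → ℕ} {Ξ : Type*} [MeasurableSpace Ξ] {F : Params m n → Ξ → ℝ}
  {D : Measure Ξ} {σ : Fin N → ℝ}

lemma norm_gradNoise_sq (x : Params m n) (y : Ξ) : ‖gradNoise F D x y‖ ^ 2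
    = ∑ ℓ, frobSq (block (stochGrad F x y) ℓ - block (gradient (objective F D) x) ℓ) := by
  rw [norm_sq_eq_sum_frobSq]
  rfl

namespace StochasticGradient

variable (hG : StochasticGradient F D σ)
include hG

lemma measurable_gradNoise (hg : Measurable (gradient (objective F D))) :
    Measurable fun p : Params m n × Ξ => gradNoise F D p.1 p.2 :=
  hG.measurable_grad.sub (hg.comp measurable_fst)

lemma integrable_gradNoise [IsProbabilityMeasure D] (x : Params m n) :
    Integrable (gradNoise F D x) D :=
  (hG.integrable_grad x).sub (integrable_const _)

lemma integral_gradNoise [IsProbabilityMeasure D] (x : Params m n) :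
    ∫ y, gradNoise F D x y ∂D = 0 := by
  simp only [gradNoise]
  rw [integral_sub (hG.integrable_grad x) (integrable_const _), hG.unbiased]
  simp

lemma integral_inner_gradNoise [IsProbabilityMeasure D] (w x : Params m n) :
    ∫ y, inner ℝ w (gradNoise F D x y) ∂D = 0 := by
  rw [integral_inner (hG.integrable_gradNoise x), hG.integral_gradNoise, inner_zero_right]

/-- Freeze `W` and `X`: the inner integral over the fresh data point is that of a fixed vector
against centred noise. -/
lemma integral_inner_gradNoise_of_indepFun [IsProbabilityMeasure D] {Ω : Type*}
    [MeasurableSpace Ω] {μ : Measure Ω} [IsProbabilityMeasure μ]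
    (hg : Measurable (gradient (objective F D))) {W X : Ω → Params m n} {Y : Ω → Ξ}
    (hW : Measurable W) (hX : Measurable X) (hY : Measurable Y) (hlaw : μ.map Y = D)
    (hind : IndepFun (fun ω => (W ω, X ω)) Y μ)
    (hint : Integrable (fun ω => inner ℝ (W ω) (gradNoise F D (X ω) (Y ω))) μ) :
    ∫ ω, inner ℝ (W ω) (gradNoise F D (X ω) (Y ω)) ∂μ = 0 := by
  have hN := hG.measurable_gradNoise hg
  have hm : Measurable fun p : (Params m n × Params m n) × Ξ =>
      inner ℝ p.1.1 (gradNoise F D p.1.2 p.2) := by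
    have h1 : Measurable fun p : (Params m n × Params m n) × Ξ => p.1.1 := by fun_prop
    have h2 : Measurable fun p : (Params m n × Params m n) × Ξ => gradNoise F D p.1.2 p.2 :=
      hN.comp (g := fun p : Params m n × Ξ => gradNoise F D p.1 p.2)
        (f := fun p : (Params m n × Params m n) × Ξ => (p.1.2, p.2)) (by fun_prop)
    exact h1.inner h2
  have h := integral_comp_of_indepFun (hW.prodMk hX) hY hind hm hint
  rw [hlaw] at h
  rw [h]
  exact integral_eq_zero_of_ae (Filter.Eventually.of_forall fun ω =>
    hG.integral_inner_gradNoise (W ω) (X ω))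

lemma integrable_norm_gradNoise_sq (x : Params m n) :
    Integrable (fun y => ‖gradNoise F D x y‖ ^ 2) D := by
  simp only [norm_gradNoise_sq]
  exact integrable_finsetSum _ fun ℓ _ => hG.integrable_sq x ℓ

lemma integral_norm_gradNoise_sq_le (x : Params m n) :
    ∫ y, ‖gradNoise F D x y‖ ^ 2 ∂D ≤ totalSigma σ ^ 2 := by
  rw [totalSigma, Real.sq_sqrt (Finset.sum_nonneg fun ℓ _ => sq_nonneg _)]
  simp only [norm_gradNoise_sq]
  rw [integral_finsetSum _ fun ℓ _ => hG.integrable_sq x ℓ]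
  exact Finset.sum_le_sum fun ℓ _ => hG.variance_le x ℓ

end StochasticGradient

end Noise

/-! ### Energy kept by a fresh random projection -/

section Energy

variable {Ω α : Type*} [MeasurableSpace Ω] [MeasurableSpace α] {μ : Measure Ω}
  [IsProbabilityMeasure μ]

/-- A uniformly random projection that is independent of a random matrix scales its expected squared
norm. -/
lemma integral_frobSq_proj_of_indepFun {a b c : ℕ} (hba : b ≤ a)
    {B : Ω → Matrix (Fin a) (Fin c) ℝ} {S : Ω → Matrix (Fin a) (Fin b) ℝ} (hB : Measurable B)
    (hS : Measurable S) (hlaw : μ.map S = stiefelUniform a b) (hBS : IndepFun B S μ)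
    (hint : Integrable (fun ω => frobSq (S ω * (S ω).transpose * B ω)) μ) :
    ∫ ω, frobSq (S ω * (S ω).transpose * B ω) ∂μ = (b : ℝ) / a * ∫ ω, frobSq (B ω) ∂μ := by
  have hm : Measurable fun p : Matrix (Fin a) (Fin c) ℝ × Matrix (Fin a) (Fin b) ℝ =>
      frobSq (p.2 * p.2.transpose * p.1) :=
    (continuous_frobSq.comp (by fun_prop)).measurable
  rw [integral_comp_of_indepFun hB hS hBS hm hint, hlaw, ← integral_const_mul]
  simp only [integral_frobSq_proj hba]

variable {N : ℕ} {m n r : Fin N → ℕ}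

/-- The blockwise projection preserves on average at least the fraction `minDelta` of the energy of
an independent vector. -/
lemma minDelta_mul_integral_le (hr : ∀ ℓ, 1 ≤ r ℓ ∧ r ℓ ≤ m ℓ ∧ r ℓ ≤ n ℓ)
    {P : ∀ ℓ, Ω → Matrix (Fin (m ℓ)) (Fin (r ℓ)) ℝ}
    {Q : ∀ ℓ, Ω → Matrix (Fin (n ℓ)) (Fin (r ℓ)) ℝ} (hP : ∀ ℓ, Measurable (P ℓ))
    (hQ : ∀ ℓ, Measurable (Q ℓ)) (hPlaw : ∀ ℓ, μ.map (P ℓ) = stiefelUniform (m ℓ) (r ℓ))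
    (hQlaw : ∀ ℓ, μ.map (Q ℓ) = stiefelUniform (n ℓ) (r ℓ)) {v : Ω → Params m n}
    (hv : Measurable v) (hind : ∀ ℓ, IndepFun v (fun ω => (P ℓ ω, Q ℓ ω)) μ)
    (hvL : MemLp v 2 μ)
    (hpv : MemLp (fun ω => blockProj (fun ℓ => P ℓ ω) (fun ℓ => Q ℓ ω) (v ω)) 2 μ) :
    minDelta m n r * ∫ ω, ‖v ω‖ ^ 2 ∂μ
      ≤ ∫ ω, ‖blockProj (fun ℓ => P ℓ ω) (fun ℓ => Q ℓ ω) (v ω)‖ ^ 2 ∂μ := by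
  have hle : ∀ (w : Params m n) ℓ, frobSq (block w ℓ) ≤ ‖w‖ ^ 2 := fun w ℓ => by
    rw [norm_sq_eq_sum_frobSq]
    exact Finset.single_le_sum (f := fun ℓ => frobSq (block w ℓ))
      (fun _ _ => frobSq_nonneg _) (Finset.mem_univ ℓ)
  have hI : ∀ {w : Ω → Params m n}, Measurable w → MemLp w 2 μ → ∀ ℓ,
      Integrable (fun ω => frobSq (block (w ω) ℓ)) μ := fun {w} hw hwL ℓ =>
    (integrable_norm_sq hwL).mono'
      (continuous_frobSq.measurable.comp (measurable_block hw ℓ)).aestronglyMeasurable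
      (Filter.Eventually.of_forall fun ω => by
        rw [Real.norm_eq_abs, abs_of_nonneg (frobSq_nonneg _)]
        exact hle _ _)
  have hpm : Measurable fun ω => blockProj (fun ℓ => P ℓ ω) (fun ℓ => Q ℓ ω) (v ω) :=
    measurable_blockProj hP hQ hv
  simp only [norm_sq_eq_sum_frobSq]
  rw [integral_finsetSum _ fun ℓ _ => hI hv hvL ℓ, integral_finsetSum _ fun ℓ _ => hI hpm hpv ℓ,
    Finset.mul_sum]
  refine Finset.sum_le_sum fun ℓ _ => ?_
  have h0 : 0 ≤ ∫ ω, frobSq (block (v ω) ℓ) ∂μ := integral_nonneg fun _ => frobSq_nonneg _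
  have hind' := (hind ℓ).comp (φ := fun w => block w ℓ) (continuous_block ℓ).measurable
    (ψ := id) measurable_id
  have hi := hI hpm hpv ℓ
  refine (mul_le_mul_of_nonneg_right (minDelta_le ℓ) h0).trans (le_of_eq ?_)
  by_cases h : m ℓ ≤ n ℓ
  · simp only [block_blockProj, h, if_true] at hi ⊢
    rw [min_eq_left h]
    exact (integral_frobSq_proj_of_indepFun (hr ℓ).2.1 (measurable_block hv ℓ) (hP ℓ) (hPlaw ℓ)
      (hind'.comp measurable_id measurable_fst) hi).symm
  -- Transposition reduces a projection from the right to one from the left.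
  · have e : ∀ ω, frobSq (block (v ω) ℓ * (Q ℓ ω * (Q ℓ ω).transpose))
        = frobSq (Q ℓ ω * (Q ℓ ω).transpose * (block (v ω) ℓ).transpose) := fun ω => by
      rw [← frobSq_transpose]
      simp only [Matrix.transpose_mul, Matrix.transpose_transpose]
    simp only [block_blockProj, h, if_false, e] at hi ⊢
    rw [min_eq_right (by omega), integral_frobSq_proj_of_indepFun (hr ℓ).2.2
      (measurable_matrix_transpose (measurable_block hv ℓ)) (hQ ℓ) (hQlaw ℓ)
      (hind'.comp (measurable_matrix_transpose measurable_id) measurable_snd) hi]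
    simp only [frobSq_transpose]

end Energy

/-! ### The bound over whole periods -/

section Main

variable {N : ℕ} {m n r : Fin N → ℕ} {Ω Ξ : Type*} [MeasurableSpace Ω] [MeasurableSpace Ξ]
  {μ : Measure Ω} [IsProbabilityMeasure μ] {D : Measure Ξ} [IsProbabilityMeasure D]
  {F : Params m n → Ξ → ℝ} {L : ℝ} {σ : Fin N → ℝ} {ξ : ℕ → Ω → Ξ}
  {P : ℕ → ∀ ℓ, Ω → Matrix (Fin (m ℓ)) (Fin (r ℓ)) ℝ}
  {Q : ℕ → ∀ ℓ, Ω → Matrix (Fin (n ℓ)) (Fin (r ℓ)) ℝ}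

/-- The two probabilistic fields use different independences: `noise_orthogonal` that of the data
point at time `t` from the state, `energy_le` that of the projections drawn at time `k * τ` from the
iterate. -/
theorem projectedMomentum (hr : ∀ ℓ, 1 ≤ r ℓ ∧ r ℓ ≤ m ℓ ∧ r ℓ ≤ n ℓ)
    (hbdd : BddBelow (Set.range (objective F D))) (hL : LSmooth (objective F D) L)
    (hG : StochasticGradient F D σ) (hS : Sampling μ D ξ P Q) (β η : ℝ) {τ : ℕ} (hτ : 0 < τ)
    (x₀ : Params m n) :
    ProjectedMomentum μ (objective F D) L β η (minDelta m n r) (totalSigma σ ^ 2) τ x₀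
      (iterate F β η τ x₀ ξ P Q) (momentumAt F β η τ x₀ ξ P Q)
      (fun t ω => gradNoise F D (iterate F β η τ x₀ ξ P Q t ω) (ξ t ω)) (projAt τ P Q) := by
  have hg : Measurable (gradient (objective F D)) :=
    (continuous_gradient_of_lipschitz hL.2).measurable
  have hF := hG.measurable_grad
  have hx : ∀ t, Measurable (iterate F β η τ x₀ ξ P Q t) := fun t =>
    measurable_iterate hF β η τ x₀ (fun s _ => hS.measurable_data s)
      (fun s _ => hS.measurable_left s) (fun s _ => hS.measurable_right s)
  have hM : ∀ t, Measurable (momentumAt F β η τ x₀ ξ P Q t) := fun t =>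
    measurable_momentumAt hF β η τ x₀ (fun s _ => hS.measurable_data s)
      hS.measurable_left hS.measurable_right
  have hA : ∀ t (w : Ω → Params m n), Measurable w → Measurable fun ω => projAt τ P Q t ω (w ω) :=
    fun t w hw => measurable_projAt τ hS.measurable_left hS.measurable_right t hw
  have horth := hS.ae_orthonormals fun ℓ => (hr ℓ).2
  have hN := hG.measurable_gradNoise hg
  have hind := fun t => hS.indepFun_state hF β η τ x₀ hg t
  -- The variance bound is uniform in the point, so it survives evaluation at the random iterate,
  -- which is independent of `ξ t`.
  have hnoise : ∀ t, Integrable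
      (fun ω => ‖gradNoise F D (iterate F β η τ x₀ ξ P Q t ω) (ξ t ω)‖ ^ 2) μ ∧
      ∫ ω, ‖gradNoise F D (iterate F β η τ x₀ ξ P Q t ω) (ξ t ω)‖ ^ 2 ∂μ
        ≤ totalSigma σ ^ 2 := fun t => by
    refine integrable_comp_of_indepFun (hx t) (hS.measurable_data t)
      ((hind t).comp measurable_snd measurable_id)
      (h := fun p => ‖gradNoise F D p.1 p.2‖ ^ 2) (hN.norm.pow_const 2)
      (fun p => by positivity) (fun x => ?_) fun x => ?_
    · rw [hS.law_data]
      exact hG.integrable_norm_gradNoise_sq x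
    · rw [hS.law_data]
      exact hG.integral_norm_gradNoise_sq_le x
  have hnoiseL : ∀ t, MemLp
      (fun ω => gradNoise F D (iterate F β η τ x₀ ξ P Q t ω) (ξ t ω)) 2 μ := fun t =>
    (memLp_two_iff_integrable_sq_norm
      (hN.comp ((hx t).prodMk (hS.measurable_data t))).aestronglyMeasurable).2 (hnoise t).1
  refine
    { period_pos := hτ
      differentiable := hL.1
      lipschitz := hL.2
      bddBelow := hbdd
      measurable_x := hx
      measurable_M := hM
      measurable_A := hA
      proj := horth.mono fun ω hω => projAt_isSymmetricProjection hω
      held := projAt_held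
      x_zero := fun _ => rfl
      x_succ := iterate_succ F β η x₀ ξ
      M_zero := momentumAt_zero F β η x₀ ξ
      M_succ := horth.mono fun ω hω t => by
        rw [momentumAt_succ F β η x₀ ξ hω t, gradNoise, add_sub_cancel]
      memLp_noise := hnoiseL
      noise_sq_le := fun t => (hnoise t).2
      noise_orthogonal := fun t hw => ?_
      energy_le := fun k hgL => ?_ }
  · exact hG.integral_inner_gradNoise_of_indepFun hg (hA t _ ((hM t).sub (hg.comp (hx t)))) (hx t)
      (hS.measurable_data t) (hS.law_data t) (hind t)
      (integrable_inner_of_memLp hw (hnoiseL t))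
  · have e : ∀ ω, projAt τ P Q (k * τ) ω
        = blockProj (fun ℓ => P (k * τ) ℓ ω) (fun ℓ => Q (k * τ) ℓ ω) := fun ω => by
      rw [projAt, held_mul, held_mul]
    have hgx := hg.comp (hx (k * τ))
    have hpL : MemLp (fun ω => projAt τ P Q (k * τ) ω
        (gradient (objective F D) (iterate F β η τ x₀ ξ P Q (k * τ) ω))) 2 μ :=
      hgL.of_le (hA _ _ hgx).aestronglyMeasurable (horth.mono fun ω hω =>
        (projAt_isSymmetricProjection hω (k * τ)).norm_apply_le _)
    simp only [e] at hpL ⊢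
    exact minDelta_mul_integral_le hr (hS.measurable_left _) (hS.measurable_right _)
      (hS.law_left _) (hS.law_right _) hgx
      (fun ℓ => (hS.indepFun_iterate_pair hF β η τ x₀ (k * τ) ℓ).comp hg measurable_id) hgL hpL

/-- The bound over `K` periods, for all admissible hyperparameters. -/
theorem average_gradient_le (hN : 0 < N) (hr : ∀ ℓ, 1 ≤ r ℓ ∧ r ℓ ≤ m ℓ ∧ r ℓ ≤ n ℓ)
    (hL0 : 0 < L) (hbdd : BddBelow (Set.range (objective F D)))
    (hL : LSmooth (objective F D) L) (hG : StochasticGradient F D σ) (hS : Sampling μ D ξ P Q)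
    {β η : ℝ} {τ K : ℕ} (x₀ : Params m n) (hβ : 0 < β) (hβ1 : β ≤ 1)
    (hτ : 64 / (3 * β * minDelta m n r) ≤ (τ : ℝ)) (hη : 0 < η)
    (hη4 : η ≤ min (min (1 / (4 * L)) √(3 * minDelta m n r * β ^ 2 / (80 * L ^ 2)))
      (min √(3 * minDelta m n r / (80 * (τ : ℝ) ^ 2 * L ^ 2)) √(3 * β / (16 * (τ : ℝ) * L ^ 2))))
    (hK : 1 ≤ K) :
    (∀ t, Integrable
      (fun ω => ‖gradient (objective F D) (iterate F β η τ x₀ ξ P Q t ω)‖ ^ 2) μ) ∧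
    1 / ((K : ℝ) * τ) * ∑ t ∈ Finset.range (K * τ),
        ∫ ω, ‖gradient (objective F D) (iterate F β η τ x₀ ξ P Q t ω)‖ ^ 2 ∂μ
      ≤ 16 * gap (objective F D) x₀ / (minDelta m n r * η * K * τ)
        + 32 * β * totalSigma σ ^ 2 / (3 * minDelta m n r) := by
  have hδ := minDelta_pos hN hr
  have hδ1 := minDelta_le_one hN hr
  have hτr : (0 : ℝ) < τ := lt_of_lt_of_le (by positivity) hτ
  have hτ0 : 0 < τ := by exact_mod_cast hτr
  obtain ⟨⟨h1, h2⟩, h3, h4⟩ := (le_min_iff.1 hη4).imp le_min_iff.1 le_min_iff.1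
  have hp := projectedMomentum hr hbdd hL hG hS β η hτ0 x₀
  refine ⟨fun t => integrable_norm_sq (hp.memLp_gradient t), ?_⟩
  rw [Real.le_sqrt hη.le (by positivity), le_div_iff₀ (by positivity)] at h2 h3 h4
  exact (hp.scalarRecursion hL0 hβ hβ1 hδ hδ1 hη h1).average_le hβ hβ1 hδ hδ1 hη (sq_nonneg _) hτ
    (by linarith) (by linarith) (by linarith) hK (hp.loss_gap_le _)

end Main

/-! ### The hyperparameters for a given horizon -/

section Hyperparameters

/-- Writing half-integer powers of `δ` as natural powers of `√δ` makes the later estimates rational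
in `√δ`. -/
lemma rpow_half_eq_sqrt_pow {δ : ℝ} (hδ : 0 ≤ δ) (k : ℕ) : δ ^ ((k : ℝ) / 2) = √δ ^ k := by
  rw [Real.rpow_div_two_eq_sqrt _ hδ, Real.rpow_natCast]

lemma rpow_three_half {δ : ℝ} (hδ : 0 ≤ δ) : δ ^ (3 / 2 : ℝ) = √δ ^ 3 := by
  exact_mod_cast rpow_half_eq_sqrt_pow hδ 3

lemma rpow_five_half {δ : ℝ} (hδ : 0 ≤ δ) : δ ^ (5 / 2 : ℝ) = √δ ^ 5 := by
  exact_mod_cast rpow_half_eq_sqrt_pow hδ 5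

lemma rpow_seven_half {δ : ℝ} (hδ : 0 ≤ δ) : δ ^ (7 / 2 : ℝ) = √δ ^ 7 := by
  exact_mod_cast rpow_half_eq_sqrt_pow hδ 7

variable {δ s L Δ : ℝ} {T : ℕ}

lemma betaT_pos : 0 < betaT δ s L Δ T := by
  unfold betaT
  positivity

lemma betaT_le_one : betaT δ s L Δ T ≤ 1 :=
  inv_le_one_of_one_le₀ (le_add_of_nonneg_right (Real.sqrt_nonneg _))

lemma le_tauT : 64 / (3 * betaT δ s L Δ T * δ) ≤ (tauT δ s L Δ T : ℝ) := by
  rw [mul_right_comm]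
  exact Nat.le_ceil _

lemma tauT_pos (hδ : 0 < δ) : 0 < (tauT δ s L Δ T : ℝ) :=
  lt_of_lt_of_le (by have := betaT_pos (δ := δ) (s := s) (L := L) (Δ := Δ) (T := T); positivity)
    le_tauT

lemma etaT_pos (hL : 0 < L) : 0 < etaT δ s L Δ T := by
  unfold etaT
  positivity

/-- The inverse of `etaT` is a sum of four positive terms, each the reciprocal of one of the four
upper limits on the step size. -/
lemma etaT_le (hL : 0 < L) (hδ : 0 < δ) : etaT δ s L Δ T
    ≤ min (min (1 / (4 * L)) √(3 * δ * betaT δ s L Δ T ^ 2 / (80 * L ^ 2)))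
      (min √(3 * δ / (80 * (tauT δ s L Δ T : ℝ) ^ 2 * L ^ 2))
        √(3 * betaT δ s L Δ T / (16 * (tauT δ s L Δ T : ℝ) * L ^ 2))) := by
  have hb := betaT_pos (δ := δ) (s := s) (L := L) (Δ := Δ) (T := T)
  have ht := tauT_pos (s := s) (L := L) (Δ := Δ) (T := T) hδ
  unfold etaT
  set b := betaT δ s L Δ T
  set t : ℝ := (tauT δ s L Δ T : ℝ)
  have h1 : 0 < √(80 * L ^ 2 / (3 * δ * b ^ 2)) := Real.sqrt_pos.2 (by positivity)
  have h2 : 0 < √(80 * t ^ 2 * L ^ 2 / (3 * δ)) := Real.sqrt_pos.2 (by positivity)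
  have h3 : 0 < √(16 * t * L ^ 2 / (3 * b)) := Real.sqrt_pos.2 (by positivity)
  have h4 : 0 < 4 * L := by positivity
  have e : ∀ y z : ℝ, √(y / z) = (√(z / y))⁻¹ := fun y z => by rw [← Real.sqrt_inv, inv_div]
  refine le_min (le_min ?_ ?_) (le_min ?_ ?_)
  · rw [one_div]
    exact inv_anti₀ h4 (by linarith)
  · rw [e (3 * δ * b ^ 2)]
    exact inv_anti₀ h1 (by linarith)
  · rw [e (3 * δ)]
    exact inv_anti₀ h2 (by linarith)
  · rw [e (3 * b)]
    exact inv_anti₀ h3 (by linarith)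

/-- Ensures that a whole period fits into the horizon. With `q` the square root in `betaT`, the last
term of the bound on `T` gives `q ≤ 3δT/128`; then `64(1 + q)/(3δ)` is at most `64/(3δ) + T/2`, and
`128/(3δ) ≤ T` finishes. -/
lemma tauT_le_horizon (hδ : 0 < δ) (hL : 0 < L) (hΔ : 0 < Δ)
    (hT : 2 + 128 / (3 * δ) + (128 * s) ^ 2 / (9 * √δ * L * Δ) ≤ (T : ℝ)) :
    tauT δ s L Δ T ≤ T := by
  have hw : 0 < √δ := Real.sqrt_pos.2 hδ
  have hδw : δ = √δ ^ 2 := (Real.sq_sqrt hδ.le).symm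
  have hT0 : (0 : ℝ) ≤ T := Nat.cast_nonneg T
  have ha : 0 ≤ 128 / (3 * δ) := by positivity
  have hb : 0 ≤ (128 * s) ^ 2 / (9 * √δ * L * Δ) := by positivity
  have hq : √(δ ^ (3 / 2 : ℝ) * s ^ 2 * T / (L * Δ)) ≤ 3 * δ * T / 128 := by
    rw [Real.sqrt_le_left (by positivity), rpow_three_half hδ.le]
    have h1 : (128 * s) ^ 2 / (9 * √δ * L * Δ) ≤ T := by linarith
    rw [div_le_iff₀ (by positivity)] at h1
    rw [div_le_iff₀ (by positivity)]
    calc √δ ^ 3 * s ^ 2 * T = (128 * s) ^ 2 * (√δ ^ 3 * T / 128 ^ 2) := by ring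
      _ ≤ T * (9 * √δ * L * Δ) * (√δ ^ 3 * T / 128 ^ 2) := by gcongr
      _ = (3 * √δ ^ 2 * T / 128) ^ 2 * (L * Δ) := by ring
      _ = _ := by rw [← hδw]
  refine Nat.ceil_le.2 ?_
  unfold betaT
  rw [← div_div, div_inv_eq_mul]
  calc 64 / (3 * δ) * (1 + √(δ ^ (3 / 2 : ℝ) * s ^ 2 * T / (L * Δ)))
      ≤ 64 / (3 * δ) * (1 + 3 * δ * T / 128) := by gcongr
    _ = 128 / (3 * δ) / 2 + T / 2 := by
        field_simp
        ring
    _ ≤ T := by linarith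

/-- Since `τ` is of order `1/(δβ)`, the term `τL/√δ` dominates and dictates the order
`L/(δ^{3/2}β)`. The four constants add up to `4 + 6 + 138 + 12 = 160`. -/
lemma inv_etaT_le (hδ : 0 < δ) (hδ1 : δ ≤ 1) (hL : 0 < L) :
    (etaT δ s L Δ T)⁻¹ ≤ 160 * L / (√δ ^ 3 * betaT δ s L Δ T) := by
  have hb := betaT_pos (δ := δ) (s := s) (L := L) (Δ := Δ) (T := T)
  have hb1 := betaT_le_one (δ := δ) (s := s) (L := L) (Δ := Δ) (T := T)
  have ht := tauT_pos (s := s) (L := L) (Δ := Δ) (T := T) hδ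
  -- The ceiling costs at most `1 ≤ 1/(δβ)`, and `64/3 + 1 ≤ 23`.
  have htle : (tauT δ s L Δ T : ℝ) ≤ 23 / (δ * betaT δ s L Δ T) := by
    have h1 := (Nat.ceil_lt_add_one (a := 64 / (3 * δ * betaT δ s L Δ T)) (by positivity)).le
    have h2 : δ * betaT δ s L Δ T ≤ 1 := mul_le_one₀ hδ1 hb.le hb1
    refine h1.trans ?_
    rw [le_div_iff₀ (by positivity), add_mul, mul_assoc 3, div_mul_eq_mul_div,
      mul_div_mul_right _ _ (by positivity)]
    linarith
  have hw : 0 < √δ := Real.sqrt_pos.2 hδ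
  have hw1 : √δ ≤ 1 := Real.sqrt_le_one.2 hδ1
  have hδw : δ = √δ ^ 2 := (Real.sq_sqrt hδ.le).symm
  unfold etaT
  rw [inv_inv]
  set b := betaT δ s L Δ T
  set t : ℝ := (tauT δ s L Δ T : ℝ)
  set w := √δ
  have hwb : w ^ 3 * b ≤ 1 := mul_le_one₀ (pow_le_one₀ hw.le hw1) hb.le hb1
  have h0 : 4 * L ≤ 4 * L / (w ^ 3 * b) := le_div_self (by positivity) (by positivity) hwb
  have hw6 : w ^ 6 ≤ w ^ 2 := pow_le_pow_of_le_one hw.le hw1 (by norm_num)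
  have h1 : √(80 * L ^ 2 / (3 * δ * b ^ 2)) ≤ 6 * L / (w ^ 3 * b) := by
    rw [Real.sqrt_le_left (by positivity), div_pow, hδw]
    calc 80 * L ^ 2 / (3 * w ^ 2 * b ^ 2) = 80 / 3 * L ^ 2 / (w ^ 2 * b ^ 2) := by
          field_simp
      _ ≤ (6 * L) ^ 2 / (w ^ 6 * b ^ 2) := by
          gcongr
          nlinarith [sq_nonneg L]
      _ = _ := by ring
  have h2 : √(80 * t ^ 2 * L ^ 2 / (3 * δ)) ≤ 138 * L / (w ^ 3 * b) := by
    rw [Real.sqrt_le_left (by positivity), div_pow]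
    calc 80 * t ^ 2 * L ^ 2 / (3 * δ) ≤ 80 * (23 / (δ * b)) ^ 2 * L ^ 2 / (3 * δ) := by gcongr
      _ = 80 / 3 * 23 ^ 2 * L ^ 2 / (w ^ 6 * b ^ 2) := by
          rw [hδw]
          field_simp
      _ ≤ (138 * L) ^ 2 / (w ^ 6 * b ^ 2) := by
          gcongr
          nlinarith [sq_nonneg L]
      _ = _ := by ring
  have h3 : √(16 * t * L ^ 2 / (3 * b)) ≤ 12 * L / (w ^ 3 * b) := by
    rw [Real.sqrt_le_left (by positivity), div_pow]
    calc 16 * t * L ^ 2 / (3 * b) ≤ 16 * (23 / (δ * b)) * L ^ 2 / (3 * b) := by gcongr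
      _ = 16 / 3 * 23 * L ^ 2 / (w ^ 2 * b ^ 2) := by
          rw [hδw]
          field_simp
      _ ≤ (12 * L) ^ 2 / (w ^ 6 * b ^ 2) := by
          gcongr
          nlinarith [sq_nonneg L]
      _ = _ := by ring
  calc _ ≤ 4 * L / (w ^ 3 * b) + 6 * L / (w ^ 3 * b) + 138 * L / (w ^ 3 * b)
        + 12 * L / (w ^ 3 * b) := by gcongr
    _ = _ := by ring

/-- The bound over `K` periods for the chosen hyperparameters, in terms of the horizon. -/
lemma hyperparameter_bound (hδ : 0 < δ) (hδ1 : δ ≤ 1) (hL : 0 < L) (hΔ : 0 < Δ) (hT : 0 < T) :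
    16 * Δ / (δ * etaT δ s L Δ T * T) + 64 * betaT δ s L Δ T * s ^ 2 / (3 * δ)
      ≤ 2600 * (L * Δ / (δ ^ (5 / 2 : ℝ) * T) + √(L * Δ * s ^ 2 / (δ ^ (7 / 2 : ℝ) * T))) := by
  have hb := betaT_pos (δ := δ) (s := s) (L := L) (Δ := Δ) (T := T)
  have hη := etaT_pos (δ := δ) (s := s) (Δ := Δ) (T := T) hL
  have hw : 0 < √δ := Real.sqrt_pos.2 hδ
  have hδw : δ = √δ ^ 2 := (Real.sq_sqrt hδ.le).symm
  have hTr : (0 : ℝ) < T := by exact_mod_cast hT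
  have hηi := inv_etaT_le (s := s) (Δ := Δ) (T := T) hδ hδ1 hL
  rw [rpow_five_half hδ.le, rpow_seven_half hδ.le]
  set R := √(L * Δ * s ^ 2 / (√δ ^ 7 * T)) with hR
  set A := L * Δ / (√δ ^ 5 * T) with hA
  have hA0 : 0 < A := by positivity
  have hR0 : 0 ≤ R := Real.sqrt_nonneg _
  -- The balance behind the choice `β = 1/(1+q)`: `A q = R` and `R q = s²/δ`. The optimization term
  -- is then a multiple of `A (1 + q) = A + R`, and the noise term a multiple of `R q/(1+q) ≤ R`.
  obtain ⟨q, hq⟩ : ∃ q, q = √(√δ ^ 3 * s ^ 2 * T / (L * Δ)) := ⟨_, rfl⟩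
  have hq0 : 0 ≤ q := hq ▸ Real.sqrt_nonneg _
  have hbq : betaT δ s L Δ T = (1 + q)⁻¹ := by rw [betaT, rpow_three_half hδ.le, hq]
  have hAq : A * q = R := by
    rw [hq, hR, ← Real.sqrt_sq hA0.le, ← Real.sqrt_mul (sq_nonneg A)]
    congr 1
    rw [hA]
    field_simp
  have hRq : R * q = s ^ 2 / δ := by
    rw [hq, hR, ← Real.sqrt_mul (by positivity)]
    rw [show L * Δ * s ^ 2 / (√δ ^ 7 * T) * (√δ ^ 3 * s ^ 2 * T / (L * Δ))
      = (s ^ 2 / √δ ^ 2) ^ 2 by field_simp, Real.sqrt_sq (by positivity), ← hδw]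
  have h1 : 16 * Δ / (δ * etaT δ s L Δ T * T) ≤ 2560 * (A + R) := by
    calc 16 * Δ / (δ * etaT δ s L Δ T * T) = 16 * Δ / (δ * T) * (etaT δ s L Δ T)⁻¹ := by
          field_simp
      _ ≤ 16 * Δ / (δ * T) * (160 * L / (√δ ^ 3 * betaT δ s L Δ T)) := by gcongr
      _ = 16 * Δ / (√δ ^ 2 * T) * (160 * L / (√δ ^ 3 * (1 + q)⁻¹)) := by rw [hbq, ← hδw]
      _ = 2560 * (A + A * q) := by
          rw [hA]
          field_simp
          ring
      _ = _ := by rw [hAq]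
  have h2 : 64 * betaT δ s L Δ T * s ^ 2 / (3 * δ) ≤ 64 / 3 * R := by
    calc 64 * betaT δ s L Δ T * s ^ 2 / (3 * δ) = 64 / 3 * (betaT δ s L Δ T * (s ^ 2 / δ)) := by
          field_simp
      _ = 64 / 3 * (R * (q / (1 + q))) := by
          rw [← hRq, hbq]
          ring
      _ ≤ 64 / 3 * (R * 1) := by
          gcongr
          exact div_le_one_of_le₀ (by linarith) (by positivity)
      _ = _ := by ring
  linarith

lemma exists_horizon (hδ : 0 < δ) (hδ1 : δ ≤ 1) (hL : 0 < L) (hΔ : 0 < Δ) {ε : ℝ} (hε : 0 < ε) :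
    ∃ T₀ : ℕ, (T₀ : ℝ) ≤ 28000000 * (L * Δ * s ^ 2 / (δ ^ (7 / 2 : ℝ) * ε ^ 2)
        + L * Δ / (δ ^ (5 / 2 : ℝ) * ε) + s ^ 2 / (√δ * L * Δ) + 1 / δ) ∧
      ∀ T : ℕ, T₀ ≤ T →
        2 + 128 / (3 * δ) + (128 * s) ^ 2 / (9 * √δ * L * Δ) ≤ (T : ℝ) ∧
        2600 * (L * Δ / (δ ^ (5 / 2 : ℝ) * T) + √(L * Δ * s ^ 2 / (δ ^ (7 / 2 : ℝ) * T))) ≤ ε := by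
  have hw : 0 < √δ := Real.sqrt_pos.2 hδ
  have hd5 : 0 < δ ^ (5 / 2 : ℝ) := Real.rpow_pos_of_pos hδ _
  have hd7 : 0 < δ ^ (7 / 2 : ℝ) := Real.rpow_pos_of_pos hδ _
  set a := L * Δ * s ^ 2 / (δ ^ (7 / 2 : ℝ) * ε ^ 2) with ha
  set b := L * Δ / (δ ^ (5 / 2 : ℝ) * ε) with hb
  have ha0 : 0 ≤ a := by positivity
  have hb0 : 0 ≤ b := by positivity
  have e1 : (128 * s) ^ 2 / (9 * √δ * L * Δ) = 128 ^ 2 / 9 * (s ^ 2 / (√δ * L * Δ)) := by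
    field_simp
  have e2 : 128 / (3 * δ) = 128 / 3 * (1 / δ) := by field_simp
  have hc0 : 0 ≤ s ^ 2 / (√δ * L * Δ) := by positivity
  have hd0 : 1 ≤ 1 / δ := by rwa [one_le_div hδ]
  rw [e1, e2]
  set c := s ^ 2 / (√δ * L * Δ)
  set d := 1 / δ
  -- With `5200 = 2 · 2600`, each term of the rate is at most `ε/5200`; the square root turns this
  -- factor into `5200²`, which is below `28000000`. The additive constants, including that of the
  -- ceiling, go into `1/δ ≥ 1`.
  refine ⟨⌈2 + 128 / 3 * d + 128 ^ 2 / 9 * c + 5200 * b + 5200 ^ 2 * a⌉₊, ?_, fun T hT => ?_⟩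
  · refine (Nat.ceil_lt_add_one (by positivity)).le.trans ?_
    linarith
  · have hT' := (Nat.le_ceil _).trans (Nat.cast_le (α := ℝ).2 hT)
    have hTr : (0 : ℝ) < T := by linarith
    refine ⟨by linarith, ?_⟩
    have h1 : L * Δ / (δ ^ (5 / 2 : ℝ) * T) ≤ ε / 5200 := by
      have : 5200 * b ≤ T := by linarith
      rw [div_le_iff₀ (by positivity)]
      calc L * Δ = 5200 * b * (ε / 5200 * δ ^ (5 / 2 : ℝ)) := by
            rw [hb]
            field_simp
        _ ≤ T * (ε / 5200 * δ ^ (5 / 2 : ℝ)) := by gcongr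
        _ = _ := by ring
    have h2 : √(L * Δ * s ^ 2 / (δ ^ (7 / 2 : ℝ) * T)) ≤ ε / 5200 := by
      have : 5200 ^ 2 * a ≤ T := by linarith
      rw [Real.sqrt_le_left (by positivity), div_le_iff₀ (by positivity)]
      calc L * Δ * s ^ 2 = 5200 ^ 2 * a * ((ε / 5200) ^ 2 * δ ^ (7 / 2 : ℝ)) := by
            rw [ha]
            field_simp
        _ ≤ T * ((ε / 5200) ^ 2 * δ ^ (7 / 2 : ℝ)) := by gcongr
        _ = _ := by ring
    linarith

/-- Passing from a bound over whole periods to a bound over the first `T` iterations. -/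
lemma average_horizon_le {g : ℕ → ℝ} (hg : ∀ t, 0 ≤ g t) {τ : ℕ} (hτ : 0 < τ) (hτT : τ ≤ T)
    {a b : ℝ} (hb : 0 ≤ b) (h : ∀ K : ℕ, 1 ≤ K →
      1 / ((K : ℝ) * τ) * ∑ t ∈ Finset.range (K * τ), g t ≤ a / (K * τ) + b) :
    1 / (T : ℝ) * ∑ t ∈ Finset.range T, g t ≤ a / T + 2 * b := by
  have hTr : (0 : ℝ) < T := by exact_mod_cast hτ.trans_le hτT
  have hτr : (0 : ℝ) < τ := by exact_mod_cast hτ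
  -- Round up to `K = T / τ + 1` periods: `K τ ≤ T + τ ≤ 2 T`. Only the constant part of the bound
  -- doubles, since the other is divided by the total length.
  obtain ⟨K, hK1, h1, h2⟩ : ∃ K : ℕ, 1 ≤ K ∧ T ≤ K * τ ∧ K * τ ≤ 2 * T := by
    have e1 := Nat.div_add_mod' T τ
    have e2 := Nat.mod_lt T hτ
    refine ⟨T / τ + 1, Nat.le_add_left _ _, ?_, ?_⟩ <;>
    · rw [add_mul]
      omega
  have hK := h K hK1
  have hKr : (0 : ℝ) < K := by exact_mod_cast hK1
  have h2r : (K : ℝ) * τ ≤ 2 * T := by exact_mod_cast h2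
  have h3 : ∑ t ∈ Finset.range T, g t ≤ ∑ t ∈ Finset.range (K * τ), g t :=
    Finset.sum_le_sum_of_subset_of_nonneg (Finset.range_subset_range.2 h1) fun t _ _ => hg t
  have hKτ : (0 : ℝ) < K * τ := by positivity
  rw [one_div_mul_eq_div, div_le_iff₀ hKτ, add_mul, div_mul_cancel₀ _ hKτ.ne'] at hK
  rw [one_div_mul_eq_div, div_le_iff₀ hTr, add_mul, div_mul_cancel₀ _ hTr.ne']
  nlinarith [mul_le_mul_of_nonneg_left h2r hb]

end Hyperparameters

/-! ### The rate for a given horizon -/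

section Rate

variable {N : ℕ} {m n r : Fin N → ℕ} {Ω Ξ : Type*} [MeasurableSpace Ω] [MeasurableSpace Ξ]
  {μ : Measure Ω} [IsProbabilityMeasure μ] {D : Measure Ξ} [IsProbabilityMeasure D]
  {F : Params m n → Ξ → ℝ} {L : ℝ} {σ : Fin N → ℝ} {ξ : ℕ → Ω → Ξ}
  {P : ℕ → ∀ ℓ, Ω → Matrix (Fin (m ℓ)) (Fin (r ℓ)) ℝ}
  {Q : ℕ → ∀ ℓ, Ω → Matrix (Fin (n ℓ)) (Fin (r ℓ)) ℝ}

/-- The rate over `T` iterations for the chosen hyperparameters. -/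
theorem average_gradient_le_of_horizon (hN : 0 < N)
    (hr : ∀ ℓ, 1 ≤ r ℓ ∧ r ℓ ≤ m ℓ ∧ r ℓ ≤ n ℓ) (hL0 : 0 < L)
    (hbdd : BddBelow (Set.range (objective F D))) (hL : LSmooth (objective F D) L)
    (hG : StochasticGradient F D σ) (hS : Sampling μ D ξ P Q) (x₀ : Params m n) {δ s Δ : ℝ}
    (hδ : δ = minDelta m n r) (hs : s = totalSigma σ) (hΔ : Δ = gap (objective F D) x₀)
    (hΔ0 : 0 < Δ) {T : ℕ}
    (hT : 2 + 128 / (3 * δ) + (128 * s) ^ 2 / (9 * √δ * L * Δ) ≤ (T : ℝ)) :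
    (∀ t, Integrable (fun ω => ‖gradient (objective F D) (iterate F (betaT δ s L Δ T)
      (etaT δ s L Δ T) (tauT δ s L Δ T) x₀ ξ P Q t ω)‖ ^ 2) μ) ∧
    1 / (T : ℝ) * ∑ t ∈ Finset.range T, ∫ ω, ‖gradient (objective F D) (iterate F
        (betaT δ s L Δ T) (etaT δ s L Δ T) (tauT δ s L Δ T) x₀ ξ P Q t ω)‖ ^ 2 ∂μ
      ≤ 2600 * (L * Δ / (δ ^ (5 / 2 : ℝ) * T)
        + √(L * Δ * s ^ 2 / (δ ^ (7 / 2 : ℝ) * T))) := by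
  have hδ0 : 0 < δ := hδ ▸ minDelta_pos hN hr
  have hδ1 : δ ≤ 1 := hδ ▸ minDelta_le_one hN hr
  have hτ0 : 0 < tauT δ s L Δ T := by
    exact_mod_cast tauT_pos (s := s) (L := L) (Δ := Δ) (T := T) hδ0
  have hτT := tauT_le_horizon hδ0 hL0 hΔ0 hT
  have hβ := betaT_pos (δ := δ) (s := s) (L := L) (Δ := Δ) (T := T)
  have hη := etaT_pos (δ := δ) (s := s) (Δ := Δ) (T := T) hL0
  have hτ := le_tauT (δ := δ) (s := s) (L := L) (Δ := Δ) (T := T)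
  have hle := etaT_le (s := s) (Δ := Δ) (T := T) hL0 hδ0
  have hK := fun (K : ℕ) (hK : 1 ≤ K) => average_gradient_le hN hr hL0 hbdd hL hG hS x₀ hβ
    betaT_le_one (by rw [← hδ]; exact hτ) hη (by rw [← hδ]; exact hle) hK
  simp only [← hδ, ← hs, ← hΔ] at hK
  refine ⟨(hK 1 le_rfl).1, ?_⟩
  have h := average_horizon_le (fun t => integral_nonneg fun _ => sq_nonneg _) hτ0 hτT
    (a := 16 * Δ / (δ * etaT δ s L Δ T)) (b := 32 * betaT δ s L Δ T * s ^ 2 / (3 * δ))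
    (by positivity) fun K h1 => by
      rw [div_div, ← mul_assoc]
      exact (hK K h1).2
  refine h.trans (le_trans (le_of_eq ?_)
    (hyperparameter_bound hδ0 hδ1 hL0 hΔ0 (hτ0.trans_le hτT)))
  rw [div_div]
  ring

end Rate

end GoLore

theorem theorem4 :
    ∃ C : ℝ, 0 < C ∧
    ∀ (N : ℕ) (m n r : Fin N → ℕ) (Ξ Ω : Type*) [MeasurableSpace Ξ] [MeasurableSpace Ω]
      (D : Measure Ξ) [IsProbabilityMeasure D] (μ : Measure Ω) [IsProbabilityMeasure μ]
      (F : Params m n → Ξ → ℝ) (L : ℝ) (σ : Fin N → ℝ) (x₀ : Params m n)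
      (ξ : ℕ → Ω → Ξ)
      (P : ℕ → ∀ ℓ, Ω → Matrix (Fin (m ℓ)) (Fin (r ℓ)) ℝ)
      (Q : ℕ → ∀ ℓ, Ω → Matrix (Fin (n ℓ)) (Fin (r ℓ)) ℝ)
      (f : Params m n → ℝ) (δ s Δ : ℝ),
      0 < N → (∀ ℓ, 1 ≤ r ℓ ∧ r ℓ ≤ m ℓ ∧ r ℓ ≤ n ℓ) →
      0 < L → (∀ ℓ, 0 ≤ σ ℓ) →
      f = objective F D → δ = minDelta m n r → s = totalSigma σ → Δ = gap f x₀ →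
      BddBelow (Set.range f) → LSmooth f L → StochasticGradient F D σ →
      Sampling μ D ξ P Q →
      -- the bound over `K` periods, for all admissible hyperparameters
      (∀ (β η : ℝ) (τ K : ℕ), 0 < β → β ≤ 1 → 64 / (3 * β * δ) ≤ (τ : ℝ) →
        0 < η →
        η ≤ min (min (1 / (4 * L)) √(3 * δ * β ^ 2 / (80 * L ^ 2)))
          (min √(3 * δ / (80 * (τ : ℝ) ^ 2 * L ^ 2)) √(3 * β / (16 * (τ : ℝ) * L ^ 2))) →
        1 ≤ K →
        (∀ t, Integrable (fun ω => ‖gradient f (iterate F β η τ x₀ ξ P Q t ω)‖ ^ 2) μ) ∧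
        1 / ((K : ℝ) * τ) * ∑ t ∈ Finset.range (K * τ),
            ∫ ω, ‖gradient f (iterate F β η τ x₀ ξ P Q t ω)‖ ^ 2 ∂μ
          ≤ 16 * Δ / (δ * η * K * τ) + 32 * β * s ^ 2 / (3 * δ)) ∧
      -- the rate over `T` iterations, for the chosen hyperparameters
      (0 < Δ → ∀ T : ℕ,
        2 + 128 / (3 * δ) + (128 * s) ^ 2 / (9 * √δ * L * Δ) ≤ (T : ℝ) →
        (∀ t, Integrable (fun ω => ‖gradient f (iterate F (betaT δ s L Δ T) (etaT δ s L Δ T)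
            (tauT δ s L Δ T) x₀ ξ P Q t ω)‖ ^ 2) μ) ∧
        1 / (T : ℝ) * ∑ t ∈ Finset.range T,
            ∫ ω, ‖gradient f (iterate F (betaT δ s L Δ T) (etaT δ s L Δ T)
              (tauT δ s L Δ T) x₀ ξ P Q t ω)‖ ^ 2 ∂μ
          ≤ C * (L * Δ / (δ ^ (5 / 2 : ℝ) * T)
              + √(L * Δ * s ^ 2 / (δ ^ (7 / 2 : ℝ) * T)))) ∧
      -- the resulting number of iterations (one stochastic gradient each) for accuracy `ε`
      (0 < Δ → ∀ ε : ℝ, 0 < ε → ∃ T₀ : ℕ,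
        (T₀ : ℝ) ≤ C * (L * Δ * s ^ 2 / (δ ^ (7 / 2 : ℝ) * ε ^ 2)
          + L * Δ / (δ ^ (5 / 2 : ℝ) * ε) + s ^ 2 / (√δ * L * Δ) + 1 / δ) ∧
        ∀ T : ℕ, T₀ ≤ T →
          2 + 128 / (3 * δ) + (128 * s) ^ 2 / (9 * √δ * L * Δ) ≤ (T : ℝ) ∧
          1 / (T : ℝ) * ∑ t ∈ Finset.range T,
              ∫ ω, ‖gradient f (iterate F (betaT δ s L Δ T) (etaT δ s L Δ T)
                (tauT δ s L Δ T) x₀ ξ P Q t ω)‖ ^ 2 ∂μ ≤ ε) := by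
  -- One constant serves both the rate, where `2600` would do, and the iteration count, where it has
  -- to exceed `5200²`.
  refine ⟨28000000, by norm_num, ?_⟩
  intro N m n r Ξ Ω _ _ D _ μ _ F L σ x₀ ξ P Q f δ s Δ hN hr hL0 _ hf hδ hs hΔ hbdd hL hG hS
  subst hf
  have hδ0 : 0 < δ := hδ ▸ minDelta_pos hN hr
  have hδ1 : δ ≤ 1 := hδ ▸ minDelta_le_one hN hr
  refine ⟨fun β η τ K hβ hβ1 hτ hη hη4 hK => ?_, fun hΔ0 T hT => ?_, fun hΔ0 ε hε => ?_⟩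
  · subst hδ hs hΔ
    exact average_gradient_le hN hr hL0 hbdd hL hG hS x₀ hβ hβ1 hτ hη hη4 hK
  · obtain ⟨h1, h2⟩ := average_gradient_le_of_horizon hN hr hL0 hbdd hL hG hS x₀ hδ hs hΔ hΔ0 hT
    refine ⟨h1, h2.trans ?_⟩
    gcongr
    norm_num
  · obtain ⟨T₀, h1, h2⟩ := exists_horizon (s := s) hδ0 hδ1 hL0 hΔ0 hε
    exact ⟨T₀, h1, fun T hT => ⟨(h2 T hT).1, (average_gradient_le_of_horizon hN hr hL0 hbdd hL hG
      hS x₀ hδ hs hΔ hΔ0 (h2 T hT).1).2.trans (h2 T hT).2⟩⟩
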